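/- Let $d\ge 2$ be an integer and $\mathbb{T}^d=\mathbb{R}^d/2\pi\mathbb{Z}^d$. For an integer $m\ge 0$ let $H^m$ be the Sobolev space of real-valued functions $u\in L^2(\mathbb{T}^d)$ with $\int_{\mathbb{T}^d}u\,dx=0$ whose weak derivatives $D^\alpha u$, $|\alpha|\le m$, all belong to $L^2(\mathbb{T}^d)$, with the norm $\|u\|_m^2=\sum_{|\alpha|\le m}\|D^\alpha u\|_{L^2}^2$. Let $H^m_\sigma$ be the space of vector fields $v=(v_1,\dots,v_d)$ with $v_j\in H^m$ for all $j$ and $\operatorname{div}v=0$ in the sense of distributions, with the norm $\|v\|_{H^m_\sigma}^2=\sum_{j=1}^d\|v_j\|_m^2$. For $T>0$ let $J_T=[0,T]$. Let $T>0$ and let $k\in\mathbb{N}$ with $k>d/2$. (i) For every $f\in H^{k+2}$ and every $v\in C(J_T;H^{k+2}_\sigma)$ there exists a unique $$\varphi_v\in C(J_T;H^{k+2})\cap L^2(J_T;H^{k+3})\cap H^1(J_T;H^{k+1})$$ such that $$\frac{\partial\varphi_v}{\partial t}+v\cdot\nabla\varphi_v-\Delta\varphi_v=0\quad\text{almost everywhere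 in } J_T\times\mathbb{T}^d,\qquad \varphi_v(0,\cdot)=f.$$ (ii) For every $R>0$ there exists a constant $C=C(R,T,k,d)>0$ such that, for all $f\in H^{k+2}$ and $v\in C(J_T;H^{k+2}_\sigma)$ with $\|f\|_{k+2}+\|v\|_{C(J_T;H^{k+2}_\sigma)}\le R$, the solution $\varphi_v$ from (i) satisfies $$\|\varphi_v\|_{C(J_T;H^{k+2})}+\|\varphi_v\|_{L^2(J_T;H^{k+3})}\le C.$$ -/

import Mathlib

open MeasureTheory Set
open scoped ContDiff Real

namespace AdvDiff

instance factTwoPiPos : Fact (0 < 2 * π) := ⟨Real.two_pi_pos⟩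

/-- The torus `ℝ^d / 2πℤ^d`; its `volume` is Lebesgue measure, of total mass `(2π)^d`. -/
abbrev Torus (d : ℕ) : Type := Fin d → AddCircle (2 * π)

/-- The quotient map `ℝ^d → ℝ^d / 2πℤ^d`. -/
noncomputable def Torus.mk (d : ℕ) (y : Fin d → ℝ) : Torus d := fun i => (y i : AddCircle (2 * π))

/-- Real scalar `L²(𝕋^d)`. -/
abbrev L2 (d : ℕ) : Type := Lp ℝ 2 (volume : Measure (Torus d))

/-- Smooth real functions on the torus: functions whose periodic lift to `ℝ^d` is smooth. -/
structure TestFunction (d : ℕ) where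
  toFun : Torus d → ℝ
  smooth : ContDiff ℝ ∞ (fun y : Fin d → ℝ => toFun (Torus.mk d y))

lemma Torus.mk_surjective (d : ℕ) : Function.Surjective (Torus.mk d) := by
  intro x
  choose y hy using fun i => QuotientAddGroup.mk_surjective (x i)
  exact ⟨y, funext hy⟩

lemma TestFunction.continuous {d : ℕ} (ψ : TestFunction d) : Continuous ψ.toFun := by
  have hq : IsOpenQuotientMap (Torus.mk d) :=
    IsOpenQuotientMap.piMap (fun _ => QuotientAddGroup.isOpenQuotientMap_mk)
  exact hq.isQuotientMap.continuous_iff.2 ψ.smooth.continuous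

/-- The classical partial derivative `∂_j ψ` of a function on the torus. -/
noncomputable def partialFun {d : ℕ} (j : Fin d) (ψ : Torus d → ℝ) (x : Torus d) : ℝ :=
  deriv (fun s : ℝ => ψ (x + Pi.single j (s : AddCircle (2 * π)))) 0

lemma partialFun_mk {d : ℕ} (j : Fin d) (ψ : TestFunction d) (y : Fin d → ℝ) :
    partialFun j ψ.toFun (Torus.mk d y) =
      fderiv ℝ (fun z : Fin d → ℝ => ψ.toFun (Torus.mk d z)) y (Pi.single j 1) := by
  rw [← DifferentiableAt.lineDeriv_eq_fderiv
    ((ψ.smooth.differentiable (by simp)).differentiableAt)]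
  unfold partialFun lineDeriv
  congr 1
  funext s
  congr 1
  funext i
  by_cases h : i = j
  · subst h; simp [Torus.mk]
  · simp [Torus.mk, h]

/-- The partial derivative as an operation on test functions. -/
noncomputable def TestFunction.partial {d : ℕ} (j : Fin d) (ψ : TestFunction d) :
    TestFunction d where
  toFun := partialFun j ψ.toFun
  smooth := by
    have h : (fun y : Fin d → ℝ => partialFun j ψ.toFun (Torus.mk d y)) = fun y =>
        fderiv ℝ (fun z : Fin d → ℝ => ψ.toFun (Torus.mk d z)) y (Pi.single j 1) :=
      funext (partialFun_mk j ψ)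
    rw [h]
    exact (ψ.smooth.fderiv_right (m := ∞) (by simp)).clm_apply contDiff_const

/-- `∂^α ψ = ∂_1^{α_1} ⋯ ∂_d^{α_d} ψ`. -/
noncomputable def TestFunction.iterPartial {d : ℕ} (α : Fin d → ℕ) (ψ : TestFunction d) :
    TestFunction d :=
  (List.finRange d).foldr (fun j φ => (TestFunction.partial j)^[α j] φ) ψ

/-- The pairing `∫_{𝕋^d} u ψ dx`. -/
noncomputable def pairing {d : ℕ} (u : L2 d) (ψ : TestFunction d) : ℝ :=
  ∫ x, u x * ψ.toFun x

lemma TestFunction.memLp {d : ℕ} (ψ : TestFunction d) :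
    MemLp ψ.toFun 2 (volume : Measure (Torus d)) := by
  obtain ⟨C, hC⟩ := isCompact_univ.exists_bound_of_continuousOn ψ.continuous.continuousOn
  exact MemLp.of_bound ψ.continuous.aestronglyMeasurable C
    (Filter.Eventually.of_forall fun x => hC x (mem_univ x))

/-- The pairing against `ψ` as a continuous linear functional on `L²`. -/
noncomputable def pairingCLM {d : ℕ} (ψ : TestFunction d) : L2 d →L[ℝ] ℝ :=
  innerSL ℝ ψ.memLp.toLp

lemma pairingCLM_apply {d : ℕ} (ψ : TestFunction d) (u : L2 d) :
    pairingCLM ψ u = pairing u ψ := by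
  rw [pairingCLM, innerSL_apply_apply, L2.inner_def, pairing]
  refine integral_congr_ae ?_
  filter_upwards [ψ.memLp.coeFn_toLp] with x hx
  rw [hx]
  simp

/-- `g` is the weak derivative `D^α u`:
`∫ u ∂^α ψ = (-1)^{|α|} ∫ g ψ` for all smooth `ψ` on the torus. -/
def IsWeakDeriv {d : ℕ} (α : Fin d → ℕ) (u g : L2 d) : Prop :=
  ∀ ψ : TestFunction d, pairing u (ψ.iterPartial α) = (-1) ^ (∑ i, α i) * pairing g ψ

/-- The constant test function `1`. -/
def TestFunction.one (d : ℕ) : TestFunction d where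
  toFun := fun _ => 1
  smooth := contDiff_const

lemma pairing_one {d : ℕ} (u : L2 d) : pairing u (TestFunction.one d) = ∫ x, u x := by
  simp [pairing, TestFunction.one]

/-- The multi-indices `α ∈ ℕ^d` with `|α| ≤ k`. -/
def multiIndices (d k : ℕ) : Finset (Fin d → ℕ) :=
  (Fintype.piFinset fun _ => Finset.range (k + 1)).filter fun α => ∑ i, α i ≤ k

lemma mem_multiIndices {d k : ℕ} {α : Fin d → ℕ} : α ∈ multiIndices d k ↔ ∑ i, α i ≤ k := by
  simp only [multiIndices, Finset.mem_filter, Fintype.mem_piFinset, Finset.mem_range,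
    and_iff_right_iff_imp]
  intro h i
  have := Finset.single_le_sum (f := α) (fun _ _ => Nat.zero_le _) (Finset.mem_univ i)
  omega

/-- The multi-index `0`. -/
def idxZero (d k : ℕ) : multiIndices d k := ⟨0, mem_multiIndices.2 (by simp)⟩

/-- The multi-index `m e_j`. -/
def idxSingle {d k : ℕ} (j : Fin d) (m : ℕ) (h : m ≤ k) : multiIndices d k :=
  ⟨Pi.single j m, mem_multiIndices.2 (by simpa using h)⟩

/-- The Sobolev space `H^k` of real functions on `𝕋^d` with zero average. A function `u ∈ H^k` is
stored together with its weak derivatives, as the family `(D^α u)_{|α| ≤ k}` of elements of `L²`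
(the weak derivatives are determined by `u`). The norm inherited from the `ℓ²`-product is the
standard one, `‖u‖_k² = ∑_{|α| ≤ k} ‖D^α u‖²_{L²}`. -/
noncomputable def H (d k : ℕ) : Submodule ℝ (PiLp 2 fun _ : multiIndices d k => L2 d) where
  carrier := {F | (∀ α, IsWeakDeriv α.1 (F (idxZero d k)) (F α)) ∧
    ∫ x, F (idxZero d k) x = 0}
  zero_mem' := by
    simp only [mem_ofPred_eq, IsWeakDeriv, ← pairing_one, ← pairingCLM_apply]
    simp
  add_mem' := by
    simp only [mem_ofPred_eq, IsWeakDeriv, ← pairing_one, ← pairingCLM_apply]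
    rintro F G ⟨hF, hF'⟩ ⟨hG, hG'⟩
    refine ⟨fun α ψ => ?_, ?_⟩
    · simp [hF α ψ, hG α ψ, mul_add]
    · simp [hF', hG']
  smul_mem' := by
    simp only [mem_ofPred_eq, IsWeakDeriv, ← pairing_one, ← pairingCLM_apply]
    rintro c F ⟨hF, hF'⟩
    refine ⟨fun α ψ => ?_, ?_⟩
    · simp [hF α ψ, mul_left_comm]
    · simp [hF']

lemma isClosed_H (d k : ℕ) : IsClosed (H d k : Set (PiLp 2 fun _ : multiIndices d k => L2 d)) := by
  have : (H d k : Set (PiLp 2 fun _ : multiIndices d k => L2 d)) =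
      (⋂ α : multiIndices d k, ⋂ ψ : TestFunction d,
        {F | pairingCLM (ψ.iterPartial α.1) (F (idxZero d k)) =
          (-1) ^ (∑ i, α.1 i) * pairingCLM ψ (F α)}) ∩
      {F | pairingCLM (TestFunction.one d) (F (idxZero d k)) = 0} := by
    ext F
    simp [H, IsWeakDeriv, pairingCLM_apply, pairing_one]
  rw [this]
  refine IsClosed.inter (isClosed_iInter fun α => isClosed_iInter fun ψ => ?_) ?_
  · exact isClosed_eq (by fun_prop) (by fun_prop)
  · exact isClosed_eq (by fun_prop) (by fun_prop)

instance (d k : ℕ) : CompleteSpace (H d k) := (isClosed_H d k).completeSpace_coe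

/-- The underlying `L²` function of an element of `H^k`. -/
noncomputable def toL2 {d k : ℕ} (u : H d k) : L2 d := u.1 (idxZero d k)

/-- The weak partial derivative `∂_j u`. -/
noncomputable def dx {d k : ℕ} (j : Fin d) (u : H d (k + 1)) : L2 d :=
  u.1 (idxSingle j 1 (by omega))

/-- The weak second derivative `∂_j² u`. -/
noncomputable def dxx {d k : ℕ} (j : Fin d) (u : H d (k + 2)) : L2 d :=
  u.1 (idxSingle j 2 (by omega))

/-- The weak Laplacian. -/
noncomputable def laplacian {d k : ℕ} (u : H d (k + 2)) : L2 d := ∑ j, dxx j u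

/-- The space `H^k_σ` of vector fields with components in `H^k` and zero distributional divergence,
with the norm `‖v‖² = ∑_j ‖v_j‖_k²`. -/
noncomputable def HSigma (d k : ℕ) : Submodule ℝ (PiLp 2 fun _ : Fin d => H d k) where
  carrier := {v | ∀ ψ : TestFunction d, ∑ j, pairing (toL2 (v j)) (ψ.partial j) = 0}
  zero_mem' := by
    simp only [mem_ofPred_eq, toL2, ← pairingCLM_apply]
    simp
  add_mem' := by
    simp only [mem_ofPred_eq, toL2, ← pairingCLM_apply]
    intro v w hv hw ψ
    simp [Finset.sum_add_distrib, hv ψ, hw ψ]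
  smul_mem' := by
    simp only [mem_ofPred_eq, toL2, ← pairingCLM_apply]
    intro c v hv ψ
    simp [← Finset.mul_sum, hv ψ]

/-- The time interval `J_T = [0, T]`. -/
abbrev J (T : ℝ) : Type := Icc (0 : ℝ) T

/-- Lebesgue measure on `[0, T]`. -/
noncomputable abbrev timeMeasure (T : ℝ) : Measure (J T) := Measure.comap Subtype.val volume

/-- The Bochner space `L²(J_T; X)`. -/
abbrev L2Time (T : ℝ) (X : Type) [NormedAddCommGroup X] : Type :=
  Lp X 2 (timeMeasure T)

/-- `g ∈ L²(J_T; H^n)` is the function `φ`, seen as a function with values in `H^n`. -/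
def Represents {d m n : ℕ} {T : ℝ} (g : L2Time T (H d n)) (φ : J T → H d m) : Prop :=
  ∀ᵐ t ∂(timeMeasure T), toL2 (g t) = toL2 (φ t)

/-- `h` is the weak derivative of `g` in `L²(J_T; X)`; thus `g ∈ H¹(J_T; X)` means that
such an `h` exists. -/
def IsWeakTimeDeriv {T : ℝ} {X : Type} [NormedAddCommGroup X] [NormedSpace ℝ X]
    (g h : L2Time T X) : Prop :=
  ∀ θ : ℝ → ℝ, ContDiff ℝ ∞ θ → tsupport θ ⊆ Ioo 0 T →
    ∫ t, deriv θ t.1 • g t ∂(timeMeasure T) = -∫ t, θ t.1 • h t ∂(timeMeasure T)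

/-- `φ ∈ C(J_T; H^{k+2})` lies in `L²(J_T; H^{k+3}) ∩ H¹(J_T; H^{k+1})` and solves
`∂_t φ + v · ∇φ - Δφ = 0` almost everywhere in `J_T × 𝕋^d`, with `φ(0) = f`. -/
structure IsSolution {d k : ℕ} {T : ℝ} (hT : 0 < T) (v : C(J T, HSigma d (k + 2)))
    (f : H d (k + 2)) (φ : C(J T, H d (k + 2))) : Prop where
  memL2 : ∃ g : L2Time T (H d (k + 3)), Represents g φ
  memH1_eq : ∃ g h : L2Time T (H d (k + 1)), Represents g φ ∧ IsWeakTimeDeriv g h ∧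
    ∀ᵐ t ∂(timeMeasure T), ∀ᵐ x : Torus d,
      toL2 (h t) x + ∑ j, toL2 ((v t).1 j) x * dx j (φ t) x - laplacian (φ t) x = 0
  initial : φ ⟨0, left_mem_Icc.2 hT.le⟩ = f

end AdvDiff

/-!
The heat operator and the advection term `v · ∇φ` are both transparent on the coefficients of
functions with respect to the real orthonormal basis of waves
`cas (n · x) = cos (n · x) + sin (n · x)`, `n ∈ ℤ^d` (the Hartley basis). A derivative maps a wave
to a multiple of a wave of the same frequency up to sign, so by Parseval and Riesz–Fischer the space
`H^m` is a weighted `ℓ²` space over the nonzero frequencies, with weight comparable to `|n|^{2m}`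
(`hasSum_weight_mul_coef_sq`, `exists_coef_eq`), and `-Δ` is multiplication by `|n|²`.

*The first order term.* The product formula for waves turns a product of functions into a
convolution of coefficient sequences. As `k + 1 > d / 2`, the sequence `(1 + |n|)^{-2(k+1)}` is
summable, and Young's inequality for weighted convolutions gives the bound
`‖v · ∇φ‖_{k+1} ≤ K ‖v‖_{k+2} ‖φ‖_{k+2}` (`exists_advection`); the mean of `v · ∇φ` vanishes since
`v` is divergence free.

*Weak solutions are mild solutions.* Testing the equation against a wave gives, for each frequency,
a scalar equation `p' = -|n|² p + F` in the weak sense. By the lemma of du Bois-Reymond its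
solutions are those of the Duhamel formula (`eq_duhamel_of_weakDeriv`, `weakDeriv_duhamel`), so
solutions are exactly the fixed points of the Duhamel map (`isSolution_iff_isMild`).

*The heat semigroup gains a derivative.* The scalar energy estimate
`p(t)² + |n|² ∫ p² ≤ p(0)² + |n|⁻² ∫ F²` (`duhamel_energy`), summed with the weights of `H^{k+2}`,
controls `C(J_T; H^{k+2})` and `L²(J_T; H^{k+3})` by the datum and the `L²(J_T; H^{k+1})` norm of the
right-hand side, which loses one derivative; this loss is exactly that of the advection term.
Existence and uniqueness then follow because an iterate of the Duhamel map is a contraction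
(`existsUnique_isMild`), and the bounds from Gronwall's inequality (`exists_mild_bound`).
The energy and fixed point arguments are carried out for abstract weighted `ℓ²` spaces
(`CoefSystem`).
-/

namespace AdvDiff

/-! ### The Hartley system on the torus -/

/-- The coordinates of a point of the torus, as angles. -/
def Torus.angle {d : ℕ} (x : Torus d) (i : Fin d) : Real.Angle := x i

lemma Torus.angle_add {d : ℕ} (x y : Torus d) (i : Fin d) :
    (x + y).angle i = x.angle i + y.angle i := rfl

/-- The phase `n · x`, as an angle. -/
noncomputable def phase {d : ℕ} (n : Fin d → ℤ) (x : Torus d) : Real.Angle :=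
  ∑ i, n i • x.angle i

/-- The function `x ↦ cas⁽ʳ⁾(n · x)`, where `cas = cos + sin`: the `r`-th derivative of `cas`
is its translate by `r π / 2`. -/
noncomputable def wave {d : ℕ} (r : ℕ) (n : Fin d → ℤ) (x : Torus d) : ℝ :=
  (phase n x + ((r * (π / 2) : ℝ) : Real.Angle)).cos +
    (phase n x + ((r * (π / 2) : ℝ) : Real.Angle)).sin

lemma phase_mk {d : ℕ} (n : Fin d → ℤ) (y : Fin d → ℝ) :
    phase n (Torus.mk d y) = ((∑ i, n i * y i : ℝ) : Real.Angle) := by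
  have h := map_sum Real.Angle.coeHom (fun i => (n i : ℝ) * y i) Finset.univ
  simp only [Real.Angle.coe_coeHom] at h
  rw [h, phase]
  refine Finset.sum_congr rfl fun i _ => ?_
  rw [Real.Angle.intCast_mul_eq_zsmul]
  rfl

lemma phase_add {d : ℕ} (n : Fin d → ℤ) (x y : Torus d) :
    phase n (x + y) = phase n x + phase n y := by
  simp only [phase, ← Finset.sum_add_distrib, ← zsmul_add, Torus.angle_add]

lemma phase_index_add {d : ℕ} (m n : Fin d → ℤ) (x : Torus d) :
    phase (m + n) x = phase m x + phase n x := by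
  simp only [phase, ← Finset.sum_add_distrib, ← add_zsmul, Pi.add_apply]

lemma phase_index_neg {d : ℕ} (n : Fin d → ℤ) (x : Torus d) :
    phase (-n) x = -phase n x := by
  simp only [phase, ← Finset.sum_neg_distrib, ← neg_zsmul, Pi.neg_apply]

lemma phase_index_sub {d : ℕ} (m n : Fin d → ℤ) (x : Torus d) :
    phase (m - n) x = phase m x - phase n x := by
  rw [sub_eq_add_neg, phase_index_add, phase_index_neg, sub_eq_add_neg]

@[simp] lemma phase_index_zero {d : ℕ} (x : Torus d) : phase 0 x = 0 := by
  simp [phase]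

lemma phase_single {d : ℕ} (n : Fin d → ℤ) (j : Fin d) (s : ℝ) :
    phase n (Pi.single j (s : AddCircle (2 * π))) = ((n j * s : ℝ) : Real.Angle) := by
  have : (Pi.single j (s : AddCircle (2 * π)) : Torus d) = Torus.mk d (Pi.single j s) := by
    funext i
    by_cases h : i = j
    · subst h; simp [Torus.mk]
    · simp [Torus.mk, h]
  rw [this, phase_mk]
  congr 1
  simp [Pi.single_apply]

lemma continuous_phase {d : ℕ} (n : Fin d → ℤ) : Continuous (phase (d := d) n) := by
  unfold phase
  refine continuous_finsetSum _ fun i _ => ?_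
  exact (continuous_zsmul (n i)).comp (continuous_apply i)

/-- The waves as test functions. -/
noncomputable def waveTest {d : ℕ} (r : ℕ) (n : Fin d → ℤ) : TestFunction d where
  toFun := wave r n
  smooth := by
    simp only [wave, phase_mk, ← Real.Angle.coe_add, Real.Angle.cos_coe, Real.Angle.sin_coe]
    fun_prop

lemma partialFun_wave {d : ℕ} (j : Fin d) (r : ℕ) (n : Fin d → ℤ) :
    partialFun j (wave r n) = fun x => n j * wave (r + 1) n x := by
  funext x
  obtain ⟨y, rfl⟩ := Torus.mk_surjective d x
  unfold partialFun
  simp only [wave, phase_add, phase_mk, phase_single, ← Real.Angle.coe_add, Real.Angle.cos_coe,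
    Real.Angle.sin_coe]
  set A := ∑ i, (n i : ℝ) * y i
  have h1 : HasDerivAt (fun s : ℝ => A + n j * s + r * (π / 2)) (n j) 0 := by
    simpa using (((hasDerivAt_id (0 : ℝ)).const_mul (n j : ℝ)).const_add A).add_const (r * (π / 2))
  rw [(h1.cos.fun_add h1.sin).deriv]
  have e : A + ((r + 1 : ℕ) : ℝ) * (π / 2) = A + (n j : ℝ) * 0 + r * (π / 2) + π / 2 := by
    push_cast; ring
  rw [e, Real.cos_add_pi_div_two, Real.sin_add_pi_div_two]
  ring

lemma wave_zero_zero {d : ℕ} (x : Torus d) : wave 0 0 x = 1 := by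
  simp [wave]

lemma wave_mul_wave {d : ℕ} (r : ℕ) (m n : Fin d → ℤ) (x : Torus d) :
    wave r m x * wave r n x =
      (phase (m - n) x).cos + (phase (m + n) x + ((r * π : ℝ) : Real.Angle)).sin := by
  obtain ⟨y, rfl⟩ := Torus.mk_surjective d x
  rw [phase_index_sub, phase_index_add]
  simp only [wave, phase_mk, ← Real.Angle.coe_add,
    ← Real.Angle.coe_sub, Real.Angle.cos_coe, Real.Angle.sin_coe]
  set a := ∑ i, (m i : ℝ) * y i
  set b := ∑ i, (n i : ℝ) * y i
  have h1 : a - b = (a + r * (π / 2)) - (b + r * (π / 2)) := by ring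
  have h2 : a + b + r * π = (a + r * (π / 2)) + (b + r * (π / 2)) := by ring
  rw [h1, h2, Real.cos_sub, Real.sin_add (a + r * (π / 2))]
  ring

/-- The product formula of the functions `cas`. -/
lemma wave_zero_mul_wave_zero {d : ℕ} (m n : Fin d → ℤ) (x : Torus d) :
    wave 0 m x * wave 0 n x =
      (wave 0 (m - n) x + wave 0 (n - m) x + wave 0 (m + n) x - wave 0 (-m - n) x) / 2 := by
  rw [wave_mul_wave]
  have h1 : n - m = -(m - n) := by abel
  have h2 : -m - n = -(m + n) := by abel
  rw [h1, h2]
  simp only [wave, phase_index_neg (m - n), phase_index_neg (m + n), Nat.cast_zero, zero_mul,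
    Real.Angle.coe_zero, add_zero, Real.Angle.cos_neg, Real.Angle.sin_neg]
  ring

/-- The derivative of `cas` is its reflection: `cas' t = cas (-t)`. -/
lemma wave_one {d : ℕ} (n : Fin d → ℤ) (x : Torus d) : wave 1 n x = wave 0 (-n) x := by
  simp only [wave, phase_index_neg, Nat.cast_one, one_mul, Nat.cast_zero, zero_mul,
    Real.Angle.coe_zero, add_zero, Real.Angle.cos_neg, Real.Angle.sin_neg,
    Real.Angle.cos_add_pi_div_two, Real.Angle.sin_add_pi_div_two]
  ring

lemma wave_two_mul {d : ℕ} (r : ℕ) (n : Fin d → ℤ) (x : Torus d) :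
    wave (2 * r) n x = (-1) ^ r * wave 0 n x := by
  obtain ⟨y, rfl⟩ := Torus.mk_surjective d x
  simp only [wave, phase_mk, ← Real.Angle.coe_add, Real.Angle.cos_coe, Real.Angle.sin_coe]
  have : ((2 * r : ℕ) : ℝ) * (π / 2) = r * π := by push_cast; ring
  rw [this, Real.cos_add_nat_mul_pi, Real.sin_add_nat_mul_pi]
  simp
  ring

lemma abs_wave_le {d : ℕ} (r : ℕ) (n : Fin d → ℤ) (x : Torus d) : |wave r n x| ≤ 2 := by
  unfold wave
  refine (abs_add_le _ _).trans ?_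
  generalize phase n x + _ = θ
  induction θ using Real.Angle.induction_on with
  | _ t =>
    rw [Real.Angle.cos_coe, Real.Angle.sin_coe]
    linarith [Real.abs_cos_le_one t, Real.abs_sin_le_one t]

/-- Translating by a half-period shows that nontrivial waves have mean zero. -/
lemma integral_phase_eq_zero {d : ℕ} {n : Fin d → ℤ} (hn : n ≠ 0) (g : Real.Angle → ℝ)
    (hg : ∀ θ, g (θ + π) = -g θ) : ∫ x : Torus d, g (phase n x) = 0 := by
  obtain ⟨j, hj⟩ : ∃ j, n j ≠ 0 := by
    by_contra! h
    exact hn (funext h)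
  have h := integral_add_right_eq_self (μ := (volume : Measure (Torus d)))
    (fun x => g (phase n x)) (Pi.single j ((π / n j : ℝ) : AddCircle (2 * π)))
  have hj' : (n j : ℝ) ≠ 0 := by exact_mod_cast hj
  simp only [phase_add, phase_single, mul_div_cancel₀ π hj', hg, integral_neg] at h
  linarith

/-- The total mass `(2π)^d` of the torus. -/
noncomputable def mass (d : ℕ) : ℝ := (volume : Measure (Torus d)).real univ

lemma mass_pos (d : ℕ) : 0 < mass d := by
  unfold mass
  exact ENNReal.toReal_pos (NeZero.ne _) (measure_ne_top _ _)

lemma integral_wave_mul_wave {d : ℕ} (r : ℕ) (m n : Fin d → ℤ) :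
    ∫ x : Torus d, wave r m x * wave r n x = if m = n then mass d else 0 := by
  have hcos : Continuous fun x : Torus d => (phase (m - n) x).cos :=
    Real.Angle.continuous_cos.comp (continuous_phase _)
  have hsin : Continuous fun x : Torus d => (phase (m + n) x + ((r * π : ℝ) : Real.Angle)).sin :=
    Real.Angle.continuous_sin.comp ((continuous_phase _).add continuous_const)
  have hi : ∀ {f : Torus d → ℝ}, Continuous f → Integrable f := fun hf =>
    hf.integrable_of_hasCompactSupport (HasCompactSupport.of_compactSpace _)
  simp only [wave_mul_wave]
  rw [integral_add (hi hcos) (hi hsin)]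
  have h2 : ∫ x : Torus d, (phase (m + n) x + ((r * π : ℝ) : Real.Angle)).sin = 0 := by
    by_cases h : m + n = 0
    · simp only [h, phase_index_zero, zero_add, Real.Angle.sin_coe, Real.sin_nat_mul_pi,
        integral_zero]
    · refine integral_phase_eq_zero h (fun θ => (θ + ((r * π : ℝ) : Real.Angle)).sin) fun θ => ?_
      rw [add_right_comm, Real.Angle.sin_add_pi]
  rw [h2, add_zero]
  split_ifs with h
  · simp [h, mass]
  · exact integral_phase_eq_zero (sub_ne_zero.2 h) _ Real.Angle.cos_add_pi

/-- The normalized waves, as elements of `L²`. -/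
noncomputable def hart {d : ℕ} (r : ℕ) (n : Fin d → ℤ) : L2 d :=
  (√(mass d))⁻¹ • (waveTest r n).memLp.toLp

lemma inner_toLp {d : ℕ} (ψ : TestFunction d) (u : L2 d) :
    inner ℝ ψ.memLp.toLp u = pairing u ψ := by
  rw [← pairingCLM_apply]; rfl

lemma pairing_toLp {d : ℕ} (ψ χ : TestFunction d) :
    pairing (χ.memLp.toLp) ψ = ∫ x, χ.toFun x * ψ.toFun x := by
  refine integral_congr_ae ?_
  filter_upwards [χ.memLp.coeFn_toLp] with x hx
  rw [hx]

lemma inner_hart {d : ℕ} (r : ℕ) (n : Fin d → ℤ) (u : L2 d) :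
    inner ℝ (hart r n) u = (√(mass d))⁻¹ * pairing u (waveTest r n) := by
  rw [hart, real_inner_smul_left, inner_toLp]

lemma orthonormal_hart (d r : ℕ) : Orthonormal ℝ (hart (d := d) r) := by
  rw [orthonormal_iff_ite]
  intro m n
  rw [inner_hart, hart, ← pairingCLM_apply, map_smul, pairingCLM_apply, pairing_toLp]
  have := integral_wave_mul_wave (d := d) r n m
  simp only [waveTest]
  rw [this]
  by_cases h : m = n
  · subst h
    have h2 := Real.mul_self_sqrt (mass_pos d).le
    have h3 : √(mass d) ≠ 0 := (Real.sqrt_pos.2 (mass_pos d)).ne'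
    simp only [if_true, smul_eq_mul]
    field_simp
    nlinarith
  · simp [h, Ne.symm h]

/-- The waves as continuous functions. -/
noncomputable def waveCont {d : ℕ} (n : Fin d → ℤ) : C(Torus d, ℝ) :=
  ⟨wave 0 n, (waveTest 0 n).continuous⟩

/-- By the product formula the span of the functions `cas` is an algebra. -/
noncomputable def waveSubalgebra (d : ℕ) : Subalgebra ℝ C(Torus d, ℝ) :=
  (Submodule.span ℝ (range (waveCont (d := d)))).toSubalgebra
    (Submodule.subset_span ⟨0, by ext x; exact wave_zero_zero x⟩) (by
      intro f g hf hg
      have hmem : ∀ n, waveCont n ∈ Submodule.span ℝ (range (waveCont (d := d))) := fun n =>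
        Submodule.subset_span ⟨n, rfl⟩
      induction hf using Submodule.span_induction with
      | mem f hf =>
        obtain ⟨m, rfl⟩ := hf
        induction hg using Submodule.span_induction with
        | mem g hg =>
          obtain ⟨n, rfl⟩ := hg
          have : waveCont m * waveCont n = (1 / 2 : ℝ) • (waveCont (m - n) + waveCont (n - m) +
              waveCont (m + n) - waveCont (-m - n)) := by
            ext x
            refine (wave_zero_mul_wave_zero m n x).trans ?_
            change _ = (1 / 2 : ℝ) * (wave 0 (m - n) x + wave 0 (n - m) x + wave 0 (m + n) x -
              wave 0 (-m - n) x)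
            ring
          rw [this]
          exact Submodule.smul_mem _ _ (sub_mem (add_mem (add_mem (hmem _) (hmem _)) (hmem _))
            (hmem _))
        | zero => simp
        | add x y _ _ hx hy => rw [mul_add]; exact add_mem hx hy
        | smul a x _ hx => rw [mul_smul_comm]; exact Submodule.smul_mem _ _ hx
      | zero => simp
      | add x y _ _ hx hy => rw [add_mul]; exact add_mem hx hy
      | smul a x _ hx => rw [smul_mul_assoc]; exact Submodule.smul_mem _ _ hx)

lemma waveSubalgebra_separatesPoints (d : ℕ) : (waveSubalgebra d).SeparatesPoints := by
  intro x y hxy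
  obtain ⟨i, hi⟩ := Function.ne_iff.1 hxy
  by_contra! h
  have key : ∀ n, wave 0 n x = wave 0 n y := fun n =>
    h _ ⟨waveCont n, Submodule.subset_span ⟨n, rfl⟩, rfl⟩
  have hp : ∀ z : Torus d, phase (Pi.single i 1) z = z.angle i := by
    intro z
    unfold phase
    rw [Finset.sum_eq_single i]
    · simp
    · intro b _ hb; simp [hb]
    · simp
  have h1 := key (Pi.single i 1)
  have h2 := key (-Pi.single i 1)
  simp only [wave, phase_index_neg, hp, Nat.cast_zero, zero_mul, Real.Angle.coe_zero, add_zero,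
    Real.Angle.cos_neg, Real.Angle.sin_neg] at h1 h2
  apply hi
  change x.angle i = y.angle i
  generalize x.angle i = θ at h1 h2 ⊢
  generalize y.angle i = η at h1 h2 ⊢
  induction θ using Real.Angle.induction_on with | _ a => ?_
  induction η using Real.Angle.induction_on with | _ b => ?_
  simp only [Real.Angle.cos_coe, Real.Angle.sin_coe] at h1 h2
  exact Real.Angle.cos_sin_inj (by linarith) (by linarith)

/-- The waves span a dense subspace of `L²`, by the Stone–Weierstrass theorem. -/
lemma span_hart_topologicalClosure (d : ℕ) :
    (Submodule.span ℝ (range (hart (d := d) 0))).topologicalClosure = ⊤ := by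
  have h1 : (waveSubalgebra d).topologicalClosure = ⊤ :=
    ContinuousMap.subalgebra_topologicalClosure_eq_top_of_separatesPoints _
      (waveSubalgebra_separatesPoints d)
  have h2 : (Submodule.span ℝ (range (waveCont (d := d)))).topologicalClosure = ⊤ := by
    have := congr_arg Subalgebra.toSubmodule h1
    exact this
  have h3 := (ContinuousMap.toLp_denseRange ℝ (volume : Measure (Torus d)) ℝ
    (p := 2) (by simp)).topologicalClosure_map_submodule h2
  rw [Submodule.map_span, ← range_comp] at h3
  rw [eq_top_iff, ← h3]
  refine Submodule.topologicalClosure_mono (Submodule.span_le.2 ?_)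
  rintro _ ⟨n, rfl⟩
  have h4 : √(mass d) ≠ 0 := (Real.sqrt_pos.2 (mass_pos d)).ne'
  have : (ContinuousMap.toLp 2 (volume : Measure (Torus d)) ℝ) (waveCont n) =
      √(mass d) • hart 0 n := by
    rw [hart, smul_smul, mul_inv_cancel₀ h4, one_smul]
    rfl
  simp only [Function.comp_apply, SetLike.mem_coe]
  erw [this]
  exact Submodule.smul_mem _ _ (Submodule.subset_span ⟨n, rfl⟩)

/-- The Hartley basis `cas(n · x) / (2π)^{d/2}`, `n ∈ ℤ^d`, of `L²`. -/
noncomputable def hartBasis (d : ℕ) : HilbertBasis (Fin d → ℤ) ℝ (L2 d) :=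
  HilbertBasis.mk (orthonormal_hart d 0) (span_hart_topologicalClosure d).ge

lemma coe_hartBasis (d : ℕ) : ⇑(hartBasis d) = hart 0 := HilbertBasis.coe_mk _ _

/-! ### Integration by parts and weak derivatives of waves -/

lemma TestFunction.hasDerivAt {d : ℕ} (ψ : TestFunction d) (j : Fin d) (x : Torus d) (s : ℝ) :
    HasDerivAt (fun s : ℝ => ψ.toFun (x + Pi.single j (s : AddCircle (2 * π))))
      (partialFun j ψ.toFun (x + Pi.single j (s : AddCircle (2 * π)))) s := by
  obtain ⟨y, rfl⟩ := Torus.mk_surjective d x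
  have h1 : ∀ s : ℝ, Torus.mk d y + Pi.single j (s : AddCircle (2 * π)) =
      Torus.mk d (y + Pi.single j s) := by
    intro s
    funext i
    by_cases h : i = j
    · subst h; simp [Torus.mk]
    · simp [Torus.mk, h]
  have h2 : Differentiable ℝ
      (fun s : ℝ => ψ.toFun (Torus.mk d y + Pi.single j (s : AddCircle (2 * π)))) := by
    simp only [h1]
    refine (ψ.smooth.differentiable (by simp)).comp ?_
    refine Differentiable.const_add _ ?_
    rw [differentiable_pi]
    intro i
    by_cases h : i = j
    · subst h; simp
    · simp [h]
  have h3 : partialFun j ψ.toFun (Torus.mk d y + Pi.single j (s : AddCircle (2 * π))) =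
      deriv (fun s : ℝ => ψ.toFun (Torus.mk d y + Pi.single j (s : AddCircle (2 * π)))) s := by
    have := deriv_comp_const_add (fun s : ℝ => ψ.toFun (Torus.mk d y +
      Pi.single j (s : AddCircle (2 * π)))) s 0
    rw [add_zero] at this
    rw [← this, partialFun]
    congr 1
    funext t
    rw [AddCircle.coe_add, Pi.single_add, add_assoc]
  rw [h3]
  exact (h2 s).hasDerivAt

/-- The product of two test functions. -/
def TestFunction.mul {d : ℕ} (ψ χ : TestFunction d) : TestFunction d where
  toFun := fun x => ψ.toFun x * χ.toFun x
  smooth := ψ.smooth.mul χ.smooth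

lemma TestFunction.partialFun_mul {d : ℕ} (j : Fin d) (ψ χ : TestFunction d) (x : Torus d) :
    partialFun j (ψ.mul χ).toFun x =
      partialFun j ψ.toFun x * χ.toFun x + ψ.toFun x * partialFun j χ.toFun x := by
  have h1 := (ψ.hasDerivAt j x 0).mul (χ.hasDerivAt j x 0)
  simp only [AddCircle.coe_zero, Pi.single_zero, add_zero] at h1
  exact h1.deriv

lemma TestFunction.integrable {d : ℕ} (ψ : TestFunction d) : Integrable ψ.toFun :=
  ψ.continuous.integrable_of_hasCompactSupport (HasCompactSupport.of_compactSpace _)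

/-- Integrals over the torus are invariant under translation, so a derivative has mean zero. -/
lemma TestFunction.integral_partialFun {d : ℕ} (j : Fin d) (ψ : TestFunction d) :
    ∫ x, partialFun j ψ.toFun x = 0 := by
  obtain ⟨C, hC⟩ := isCompact_univ.exists_bound_of_continuousOn
    (ψ.partial j).continuous.continuousOn
  have hs : ∀ (χ : TestFunction d) (a : Torus d),
      AEStronglyMeasurable (fun x => χ.toFun (x + a)) volume := fun χ a =>
    (χ.continuous.comp (continuous_id.add continuous_const)).aestronglyMeasurable
  obtain ⟨a, ha⟩ : ∃ a : ℝ → Torus d, ∀ s, a s = Pi.single j (s : AddCircle (2 * π)) :=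
    ⟨_, fun _ => rfl⟩
  have ha0 : a 0 = 0 := by rw [ha, AddCircle.coe_zero, Pi.single_zero]
  have hd : ∀ x s, HasDerivAt (fun s => ψ.toFun (x + a s)) (partialFun j ψ.toFun (x + a s)) s := by
    intro x s
    simp only [ha]
    exact ψ.hasDerivAt j x s
  have key := hasDerivAt_integral_of_dominated_loc_of_deriv_le (𝕜 := ℝ) (μ := volume)
    (F := fun (s : ℝ) x => ψ.toFun (x + a s)) (F' := fun (s : ℝ) x => partialFun j ψ.toFun (x + a s))
    (x₀ := 0) (bound := fun _ => C) (s := univ) Filter.univ_mem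
    (Filter.Eventually.of_forall fun s => hs ψ (a s)) (by simpa [ha0] using ψ.integrable)
    (hs (ψ.partial j) (a 0))
    (Filter.Eventually.of_forall fun x s _ => hC _ (mem_univ _))
    (integrable_const C)
    (Filter.Eventually.of_forall fun x s _ => hd x s)
  have h3 := key.2
  simp only [integral_add_right_eq_self (μ := (volume : Measure (Torus d))) ψ.toFun, ha0,
    add_zero] at h3
  exact h3.unique (hasDerivAt_const _ _)

lemma TestFunction.integral_mul_partialFun {d : ℕ} (j : Fin d) (ψ χ : TestFunction d) :
    ∫ x, ψ.toFun x * partialFun j χ.toFun x = -∫ x, partialFun j ψ.toFun x * χ.toFun x := by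
  have h := (ψ.mul χ).integral_partialFun j
  simp only [TestFunction.partialFun_mul] at h
  rw [integral_add] at h
  · linarith
  · exact ((ψ.partial j).mul χ).integrable
  · exact (ψ.mul (χ.partial j)).integrable

/-- The monomial `n^α`. -/
def monom {d : ℕ} (n : Fin d → ℤ) (α : Fin d → ℕ) : ℝ := ∏ i, (n i : ℝ) ^ α i

lemma iterPartial_wave {d : ℕ} (r : ℕ) (n : Fin d → ℤ) (α : Fin d → ℕ) :
    ((waveTest r n).iterPartial α).toFun =
      fun x => monom n α * wave (r + ∑ i, α i) n x := by
  have h1 : ∀ (j : Fin d) (a s : ℕ) (c : ℝ) (ψ : TestFunction d),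
      (ψ.toFun = fun x => c * wave s n x) →
      ((TestFunction.partial j)^[a] ψ).toFun = fun x => ((n j : ℝ) ^ a * c) * wave (s + a) n x := by
    intro j a
    induction a with
    | zero => intro s c ψ h; simpa using h
    | succ a ih =>
      intro s c ψ h
      rw [Function.iterate_succ_apply, ih (s + 1) (c * n j)]
      · funext x
        rw [add_right_comm s 1 a, add_assoc, pow_succ]
        ring
      · change partialFun j ψ.toFun = _
        rw [h]
        funext x
        have := congr_fun (partialFun_wave j s n) x
        unfold partialFun at this ⊢
        rw [deriv_const_mul_field, this]
        ring
  have h2 : ∀ l : List (Fin d),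
      (l.foldr (fun j φ => (TestFunction.partial j)^[α j] φ) (waveTest r n)).toFun =
        fun x => (l.map fun i => (n i : ℝ) ^ α i).prod * wave (r + (l.map α).sum) n x := by
    intro l
    induction l with
    | nil => funext x; simp [waveTest]
    | cons j l ih =>
      rw [List.foldr_cons, h1 j (α j) _ _ _ ih]
      funext x
      rw [List.map_cons, List.prod_cons, List.map_cons, List.sum_cons, add_assoc,
        add_comm (α j)]
  rw [TestFunction.iterPartial, h2, monom, Fin.prod_univ_def, Fin.sum_univ_def]

/-- Moving `∂^α` from a test function to a wave. -/
lemma integral_wave_mul_iterPartial {d : ℕ} (n : Fin d → ℤ) (α : Fin d → ℕ)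
    (ψ : TestFunction d) :
    ∫ x, wave 0 n x * (ψ.iterPartial α).toFun x =
      (-1) ^ (∑ i, α i) * (monom n α * ∫ x, wave (∑ i, α i) n x * ψ.toFun x) := by
  have h0 : ∀ (j : Fin d) (s : ℕ) (ψ : TestFunction d),
      ∫ x, wave s n x * (ψ.partial j).toFun x = -n j * ∫ x, wave (s + 1) n x * ψ.toFun x := by
    intro j s ψ
    have := (waveTest s n).integral_mul_partialFun j ψ
    simp only [waveTest, partialFun_wave, mul_assoc] at this
    rw [integral_const_mul] at this
    rw [neg_mul, ← this]
    rfl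
  have h1 : ∀ (j : Fin d) (a s : ℕ) (ψ : TestFunction d),
      ∫ x, wave s n x * ((TestFunction.partial j)^[a] ψ).toFun x =
        (-n j : ℝ) ^ a * ∫ x, wave (s + a) n x * ψ.toFun x := by
    intro j a
    induction a with
    | zero => intro s ψ; simp
    | succ a ih =>
      intro s ψ
      rw [Function.iterate_succ_apply, ih, h0, ← mul_assoc, pow_succ, add_assoc]
  have h2 : ∀ (l : List (Fin d)) (s : ℕ),
      ∫ x, wave s n x * (l.foldr (fun j φ => (TestFunction.partial j)^[α j] φ) ψ).toFun x =
        (l.map fun i => (-n i : ℝ) ^ α i).prod *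
          ∫ x, wave (s + (l.map α).sum) n x * ψ.toFun x := by
    intro l
    induction l with
    | nil => intro s; simp
    | cons j l ih =>
      intro s
      rw [List.foldr_cons, h1, ih, List.map_cons, List.prod_cons, List.map_cons, List.sum_cons,
        add_assoc, mul_assoc]
  rw [TestFunction.iterPartial, h2, ← Fin.prod_univ_def, ← Fin.sum_univ_def, monom, ← mul_assoc,
    zero_add]
  congr 1
  rw [← Finset.prod_pow_eq_pow_sum, ← Finset.prod_mul_distrib]
  exact Finset.prod_congr rfl fun i _ => neg_pow _ _

/-- Shifting the phase index by `|α|` compensates for the derivative `D^α`, so that the coefficients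
of `D^α u` are those of `u` up to the factor `n^α`. -/
lemma inner_hart_of_isWeakDeriv {d : ℕ} {α : Fin d → ℕ} {u g : L2 d} (h : IsWeakDeriv α u g)
    (n : Fin d → ℤ) :
    inner ℝ (hart (∑ i, α i) n) g = monom n α * inner ℝ (hart 0 n) u := by
  have h1 := h (waveTest (∑ i, α i) n)
  have h2 : pairing u ((waveTest (∑ i, α i) n).iterPartial α) =
      (-1) ^ (∑ i, α i) * (monom n α * pairing u (waveTest 0 n)) := by
    unfold pairing
    rw [iterPartial_wave, ← two_mul]
    simp only [wave_two_mul]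
    rw [← integral_const_mul, ← integral_const_mul]
    refine integral_congr_ae (Filter.Eventually.of_forall fun x => ?_)
    simp only [waveTest]
    ring
  rw [h2] at h1
  have h3 := mul_left_cancel₀ (pow_ne_zero _ (by norm_num)) h1
  rw [inner_hart, inner_hart, ← h3]
  ring

lemma isWeakDeriv_hart {d : ℕ} (n : Fin d → ℤ) (α : Fin d → ℕ) :
    IsWeakDeriv α (hart 0 n) (monom n α • hart (∑ i, α i) n) := by
  intro ψ
  have h : ∀ r (χ : TestFunction d), pairing (hart r n) χ =
      (√(mass d))⁻¹ * ∫ x, wave r n x * χ.toFun x := by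
    intro r χ
    rw [hart, ← pairingCLM_apply, map_smul, pairingCLM_apply, pairing_toLp]
    rfl
  rw [h, integral_wave_mul_iterPartial, ← pairingCLM_apply ψ, map_smul, pairingCLM_apply, h]
  simp only [smul_eq_mul]
  ring

/-! ### The Hartley basis of the Sobolev spaces -/

lemma toL2_ext {d : ℕ} {u v : L2 d} (h : ∀ n, inner ℝ (hart 0 n) u = inner ℝ (hart 0 n) v) :
    u = v := by
  refine (hartBasis d).repr.injective ?_
  ext n
  simpa only [HilbertBasis.repr_apply_apply, coe_hartBasis] using h n

/-- The Hartley coefficient of an element of `H^m`. -/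
noncomputable def coef {d m : ℕ} (n : Fin d → ℤ) : H d m →L[ℝ] ℝ :=
  (innerSL ℝ (hart 0 n)).comp ((PiLp.proj 2 (fun _ : multiIndices d m => L2 d)
    (idxZero d m)).comp (H d m).subtypeL)

lemma coef_apply {d m : ℕ} (n : Fin d → ℤ) (u : H d m) :
    coef n u = inner ℝ (hart 0 n) (toL2 u) := rfl

lemma coef_zero {d m : ℕ} (u : H d m) : coef 0 u = 0 := by
  have h := u.2.2
  rw [← pairing_one] at h
  rw [coef_apply, inner_hart]
  have : waveTest 0 0 = TestFunction.one d := by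
    unfold waveTest TestFunction.one
    congr
    funext x
    exact wave_zero_zero x
  rw [this]
  exact mul_eq_zero_of_right _ h

lemma inner_hart_deriv {d m : ℕ} (u : H d m) (α : multiIndices d m) (n : Fin d → ℤ) :
    inner ℝ (hart (∑ i, α.1 i) n) (u.1 α) = monom n α.1 * coef n u :=
  inner_hart_of_isWeakDeriv (u.2.1 α) n

lemma toL2_eq_of_coef {d m m' : ℕ} {u : H d m} {v : H d m'} (h : ∀ n, n ≠ 0 → coef n u = coef n v) :
    toL2 u = toL2 v := by
  refine toL2_ext fun n => ?_
  by_cases hn : n = 0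
  · rw [← coef_apply, ← coef_apply, hn, coef_zero, coef_zero]
  · exact h n hn

/-- An element of `H^m` is determined by the underlying function. -/
lemma H_ext {d m : ℕ} {u v : H d m} (h : toL2 u = toL2 v) : u = v := by
  rw [← sub_eq_zero]
  set w := u - v
  have hw : toL2 w = 0 := by
    change u.1 _ - v.1 _ = 0
    exact sub_eq_zero.2 h
  have hD : ∀ α, w.1 α = 0 := by
    intro α
    refine toL2_ext fun n => ?_
    have h1 := w.2.1 α (waveTest 0 n)
    have h2 : pairing (w.1 (idxZero d m)) ((waveTest 0 n).iterPartial α.1) = 0 := by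
      rw [← pairingCLM_apply]
      change pairingCLM _ (toL2 w) = 0
      rw [hw, map_zero]
    rw [h2] at h1
    have h3 := (mul_eq_zero.1 h1.symm).resolve_left (pow_ne_zero _ (by norm_num))
    rw [inner_hart, h3, mul_zero, inner_zero_right]
  apply Subtype.ext
  apply PiLp.ext
  exact hD

/-- The square of the `H^m` norm of a wave of `L²` norm one: `∑_{|α| ≤ m} n^{2α}`. -/
noncomputable def weight {d : ℕ} (m : ℕ) (n : Fin d → ℤ) : ℝ :=
  ∑ α ∈ multiIndices d m, monom n α ^ 2

lemma one_le_weight {d : ℕ} (m : ℕ) (n : Fin d → ℤ) : 1 ≤ weight m n := by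
  have h0 : (0 : Fin d → ℕ) ∈ multiIndices d m := mem_multiIndices.2 (by simp)
  have := Finset.single_le_sum (f := fun α => monom n α ^ 2) (fun _ _ => sq_nonneg _) h0
  simpa [monom, weight] using this

lemma weight_pos {d : ℕ} (m : ℕ) (n : Fin d → ℤ) : 0 < weight m n :=
  one_pos.trans_le (one_le_weight m n)

/-- The wave `hart 0 n` of nonzero frequency, of `L²` norm one, as an element of `H^m`. -/
noncomputable def hWave {d : ℕ} (m : ℕ) (n : {n : Fin d → ℤ // n ≠ 0}) : H d m :=
  ⟨WithLp.toLp 2 fun α => monom n.1 α.1 • hart (∑ i, α.1 i) n.1, by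
    have h0 : monom n.1 (0 : Fin d → ℕ) • hart (∑ i, (0 : Fin d → ℕ) i) n.1 = hart 0 n.1 := by
      simp [monom]
    refine ⟨fun α => ?_, ?_⟩
    · change IsWeakDeriv α.1 (monom n.1 (0 : Fin d → ℕ) • hart (∑ i, (0 : Fin d → ℕ) i) n.1) _
      rw [h0]
      exact isWeakDeriv_hart n.1 α.1
    · rw [← pairing_one]
      change pairing (monom n.1 (0 : Fin d → ℕ) • hart (∑ i, (0 : Fin d → ℕ) i) n.1) _ = 0
      rw [h0, hart, ← pairingCLM_apply, map_smul, pairingCLM_apply, pairing_toLp]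
      have := integral_wave_mul_wave 0 n.1 0
      simp only [wave_zero_zero, n.2, if_false] at this
      simp only [TestFunction.one, waveTest]
      rw [this, smul_zero]⟩

lemma inner_hWave {d m : ℕ} (n : {n : Fin d → ℤ // n ≠ 0}) (u : H d m) :
    inner ℝ (hWave m n) u = weight m n.1 * coef n.1 u := by
  have h : weight m n.1 * coef n.1 u =
      ∑ α : multiIndices d m, monom n.1 α.1 ^ 2 * coef n.1 u := by
    rw [weight, Finset.sum_mul]
    exact (Finset.sum_coe_sort (multiIndices d m) fun α => monom n.1 α ^ 2 * coef n.1 u).symm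
  rw [Submodule.coe_inner (H d m), PiLp.inner_apply, h]
  refine Finset.sum_congr rfl fun α _ => ?_
  change inner ℝ (monom n.1 α.1 • hart (∑ i, α.1 i) n.1) (u.1 α) = _
  rw [real_inner_smul_left, inner_hart_deriv]
  ring

lemma coef_hWave {d m : ℕ} (n n' : {n : Fin d → ℤ // n ≠ 0}) :
    coef n.1 (hWave m n') = if n = n' then 1 else 0 := by
  rw [coef_apply]
  have : toL2 (hWave m n') = hart 0 n'.1 := by
    change monom n'.1 (0 : Fin d → ℕ) • hart (∑ i, (0 : Fin d → ℕ) i) n'.1 = hart 0 n'.1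
    simp [monom]
  rw [this, orthonormal_iff_ite.1 (orthonormal_hart d 0)]
  simp only [Subtype.ext_iff]

lemma orthonormal_hWave (d m : ℕ) :
    Orthonormal ℝ fun n : {n : Fin d → ℤ // n ≠ 0} => (√(weight m n.1))⁻¹ • hWave m n := by
  rw [orthonormal_iff_ite]
  intro n n'
  rw [real_inner_smul_left (F := H d m), real_inner_smul_right (F := H d m), inner_hWave,
    coef_hWave]
  split_ifs with h
  · subst h
    have h2 := Real.mul_self_sqrt (weight_pos m n.1).le
    have h3 : √(weight m n.1) ≠ 0 := (Real.sqrt_pos.2 (weight_pos m n.1)).ne'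
    field_simp
    nlinarith
  · simp

/-- Elements of `H^m` have mean zero, so the wave of frequency `0` is not needed. -/
lemma orthogonal_span_hWave (d m : ℕ) :
    (Submodule.span ℝ (range fun n : {n : Fin d → ℤ // n ≠ 0} =>
      (√(weight m n.1))⁻¹ • hWave (d := d) m n))ᗮ = ⊥ := by
  rw [Submodule.eq_bot_iff]
  intro u hu
  refine H_ext (toL2_eq_of_coef fun n hn => ?_)
  have h1 := (Submodule.mem_orthogonal _ _).1 hu _ (Submodule.subset_span ⟨⟨n, hn⟩, rfl⟩)
  rw [real_inner_smul_left (F := H d m), inner_hWave] at h1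
  have h3 : (√(weight m n))⁻¹ ≠ 0 := inv_ne_zero (Real.sqrt_pos.2 (weight_pos m n)).ne'
  rw [map_zero]
  exact (mul_eq_zero.1 ((mul_eq_zero.1 h1).resolve_left h3)).resolve_left (weight_pos m n).ne'

/-- The orthonormal basis of `H^m` formed by the waves of nonzero frequency,
scaled to have `H^m` norm one. -/
noncomputable def hBasis (d m : ℕ) : HilbertBasis {n : Fin d → ℤ // n ≠ 0} ℝ (H d m) :=
  HilbertBasis.mkOfOrthogonalEqBot (orthonormal_hWave d m) (orthogonal_span_hWave d m)

lemma hBasis_apply {d m : ℕ} (n : {n : Fin d → ℤ // n ≠ 0}) :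
    hBasis d m n = (√(weight m n.1))⁻¹ • hWave m n := by
  unfold hBasis
  rw [HilbertBasis.coe_mkOfOrthogonalEqBot]

lemma hBasis_repr {d m : ℕ} (u : H d m) (n : {n : Fin d → ℤ // n ≠ 0}) :
    (hBasis d m).repr u n = √(weight m n.1) * coef n.1 u := by
  rw [HilbertBasis.repr_apply_apply, hBasis_apply, real_inner_smul_left (F := H d m), inner_hWave,
    ← mul_assoc]
  congr 1
  have h3 : √(weight m n.1) ≠ 0 := (Real.sqrt_pos.2 (weight_pos m n.1)).ne'
  rw [inv_mul_eq_iff_eq_mul₀ h3, Real.mul_self_sqrt (weight_pos m n.1).le]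

lemma hasSum_repr_sq {ι E : Type*} [NormedAddCommGroup E] [InnerProductSpace ℝ E]
    (b : HilbertBasis ι ℝ E) (u : E) : HasSum (fun i => b.repr u i ^ 2) (‖u‖ ^ 2) := by
  have := b.hasSum_inner_mul_inner u u
  rw [real_inner_self_eq_norm_sq] at this
  refine this.congr_fun fun i => ?_
  rw [HilbertBasis.repr_apply_apply, real_inner_comm u (b i), sq]

/-- Parseval's identity in `H^m`. -/
lemma hasSum_weight_mul_coef_sq {d m : ℕ} (u : H d m) :
    HasSum (fun n : {n : Fin d → ℤ // n ≠ 0} => weight m n.1 * coef n.1 u ^ 2) (‖u‖ ^ 2) := by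
  refine (hasSum_repr_sq (hBasis d m) u).congr_fun fun n => ?_
  rw [hBasis_repr, mul_pow, Real.sq_sqrt (weight_pos m n.1).le]

/-- The Riesz–Fischer theorem in `H^m`. -/
lemma exists_coef_eq {d m : ℕ} {a : {n : Fin d → ℤ // n ≠ 0} → ℝ}
    (ha : Summable fun n => weight m n.1 * a n ^ 2) :
    ∃ u : H d m, ∀ n, coef n.1 u = a n := by
  have hmem : Memℓp (fun n => √(weight m n.1) * a n) 2 := by
    refine memℓp_gen ?_
    refine ha.congr fun n => ?_
    simp only [ENNReal.toReal_ofNat, Real.rpow_ofNat, Real.norm_eq_abs, sq_abs, mul_pow,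
      Real.sq_sqrt (weight_pos m n.1).le]
  refine ⟨(hBasis d m).repr.symm ⟨_, hmem⟩, fun n => ?_⟩
  have h := hBasis_repr ((hBasis d m).repr.symm ⟨_, hmem⟩) n
  rw [LinearIsometryEquiv.apply_symm_apply] at h
  exact (mul_left_cancel₀ (Real.sqrt_pos.2 (weight_pos m n.1)).ne' h).symm

lemma hasSum_inner_hart_mul {d : ℕ} (u v : L2 d) :
    HasSum (fun n => inner ℝ (hart 0 n) u * inner ℝ (hart 0 n) v) (inner ℝ u v) := by
  have := (hartBasis d).hasSum_inner_mul_inner u v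
  rw [coe_hartBasis] at this
  refine this.congr_fun fun i => ?_
  rw [real_inner_comm u]

/-- First derivatives in terms of Hartley coefficients. -/
lemma inner_hart_dx {d m : ℕ} (j : Fin d) (u : H d (m + 1)) (n : Fin d → ℤ) :
    inner ℝ (hart 0 n) (dx j u) = -n j * coef (-n) u := by
  have h := u.2.1 (idxSingle j 1 (by omega)) (waveTest 0 n)
  have h1 : ∑ i, (Pi.single j 1 : Fin d → ℕ) i = 1 := by simp
  have h2 : monom n (Pi.single j 1) = n j := by
    unfold monom
    rw [Finset.prod_eq_single j]
    · simp
    · intro b _ hb; simp [hb]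
    · simp
  have h3 : pairing (u.1 (idxZero d (m + 1))) ((waveTest 0 n).iterPartial (Pi.single j 1)) =
      n j * pairing (toL2 u) (waveTest 0 (-n)) := by
    unfold pairing
    rw [iterPartial_wave, h1, h2, ← integral_const_mul]
    refine integral_congr_ae (Filter.Eventually.of_forall fun x => ?_)
    simp only [waveTest, zero_add, wave_one]
    change toL2 u x * _ = _
    ring
  simp only [idxSingle] at h
  rw [h3, h1] at h
  rw [coef_apply, inner_hart, inner_hart]
  change _ * pairing (u.1 _) _ = _
  linear_combination (norm := (simp only [idxSingle]; ring)) (√(mass d))⁻¹ * h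

lemma inner_hart_dxx {d m : ℕ} (j : Fin d) (u : H d (m + 2)) (n : Fin d → ℤ) :
    inner ℝ (hart 0 n) (dxx j u) = -(n j : ℝ) ^ 2 * coef n u := by
  have h := u.2.1 (idxSingle j 2 (by omega)) (waveTest 0 n)
  have h1 : ∑ i, (Pi.single j 2 : Fin d → ℕ) i = 2 := by simp
  have h2 : monom n (Pi.single j 2) = (n j : ℝ) ^ 2 := by
    unfold monom
    rw [Finset.prod_eq_single j]
    · simp
    · intro b _ hb; simp [hb]
    · simp
  have h3 : pairing (u.1 (idxZero d (m + 2))) ((waveTest 0 n).iterPartial (Pi.single j 2)) =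
      -(n j : ℝ) ^ 2 * pairing (toL2 u) (waveTest 0 n) := by
    unfold pairing
    rw [iterPartial_wave, h1, h2, ← integral_const_mul]
    refine integral_congr_ae (Filter.Eventually.of_forall fun x => ?_)
    have := wave_two_mul 1 n x
    simp only [mul_one, pow_one] at this
    simp only [waveTest, zero_add, this]
    change toL2 u x * _ = _
    ring
  simp only [idxSingle] at h
  rw [h3, h1] at h
  rw [coef_apply, inner_hart, inner_hart]
  change _ * pairing (u.1 _) _ = _
  linear_combination (norm := (simp only [idxSingle]; ring)) (-(√(mass d))⁻¹) * h

/-- The symbol `|n|²` of `-Δ`. -/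
def freqSq {d : ℕ} (n : Fin d → ℤ) : ℝ := ∑ j, (n j : ℝ) ^ 2

lemma inner_hart_laplacian {d m : ℕ} (u : H d (m + 2)) (n : Fin d → ℤ) :
    inner ℝ (hart 0 n) (laplacian u) = -freqSq n * coef n u := by
  rw [laplacian, inner_sum, freqSq, ← Finset.sum_neg_distrib, Finset.sum_mul]
  exact Finset.sum_congr rfl fun j _ => inner_hart_dxx j u n

/-! ### Comparison of the Sobolev weights with powers of the frequency -/

/-- The weight `1 + ‖n‖`, with `‖n‖` the supremum norm of the frequency. -/
noncomputable def br {d : ℕ} (n : Fin d → ℤ) : ℝ := 1 + ‖n‖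

lemma one_le_br {d : ℕ} (n : Fin d → ℤ) : 1 ≤ br n := by
  unfold br; linarith [norm_nonneg n]

lemma br_neg {d : ℕ} (n : Fin d → ℤ) : br (-n) = br n := by
  simp [br]

lemma abs_le_br {d : ℕ} (n : Fin d → ℤ) (j : Fin d) : |(n j : ℝ)| ≤ br n := by
  have := norm_le_pi_norm n j
  rw [Int.norm_eq_abs] at this
  unfold br; linarith

lemma weight_le {d : ℕ} (m : ℕ) (n : Fin d → ℤ) :
    weight m n ≤ (multiIndices d m).card * br n ^ (2 * m) := by
  unfold weight
  rw [← nsmul_eq_mul]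
  refine Finset.sum_le_card_nsmul _ _ _ fun α hα => ?_
  have h1 : |monom n α| ≤ br n ^ m := by
    unfold monom
    rw [Finset.abs_prod]
    calc ∏ i, |(n i : ℝ) ^ α i| ≤ ∏ i, br n ^ α i := by
          refine Finset.prod_le_prod (fun i _ => abs_nonneg _) fun i _ => ?_
          rw [abs_pow]
          exact pow_le_pow_left₀ (abs_nonneg _) (abs_le_br n i) _
      _ = br n ^ ∑ i, α i := Finset.prod_pow_eq_pow_sum _ _ _
      _ ≤ br n ^ m := pow_le_pow_right₀ (one_le_br n) (mem_multiIndices.1 hα)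
  rw [← sq_abs, mul_comm 2 m, pow_mul]
  exact pow_le_pow_left₀ (abs_nonneg _) h1 2

lemma exists_norm_eq {d : ℕ} {n : Fin d → ℤ} (hn : n ≠ 0) : ∃ j, ‖n‖ = |(n j : ℝ)| := by
  obtain ⟨i, hi⟩ := Function.ne_iff.1 hn
  have : Nonempty (Fin d) := ⟨i⟩
  obtain ⟨j, hj⟩ := Finite.exists_max fun j => ‖n j‖
  refine ⟨j, ?_⟩
  rw [← Int.norm_eq_abs]
  exact le_antisymm ((pi_norm_le_iff_of_nonneg (norm_nonneg _)).2 hj) (norm_le_pi_norm n j)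

lemma one_le_norm {d : ℕ} {n : Fin d → ℤ} (hn : n ≠ 0) : 1 ≤ ‖n‖ := by
  obtain ⟨i, hi⟩ := Function.ne_iff.1 hn
  refine le_trans ?_ (norm_le_pi_norm n i)
  rw [Int.norm_eq_abs]
  exact_mod_cast Int.one_le_abs hi

/-- Only the term of `weight m n` with `α = m e_j` is used, where `|n_j|` is maximal. -/
lemma br_pow_le_weight {d : ℕ} (m : ℕ) (n : Fin d → ℤ) :
    br n ^ (2 * m) ≤ 4 ^ m * weight m n := by
  by_cases hn : n = 0
  · have h1 : br n ^ (2 * m) = 1 := by simp [hn, br]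
    rw [h1]
    exact one_le_mul_of_one_le_of_one_le (one_le_pow₀ (by norm_num)) (one_le_weight m n)
  · obtain ⟨j, hj⟩ := exists_norm_eq hn
    have h1 := one_le_norm hn
    have h2 : ‖n‖ ^ (2 * m) ≤ weight m n := by
      have h3 : (Pi.single j m : Fin d → ℕ) ∈ multiIndices d m := mem_multiIndices.2 (by simp)
      have h4 := Finset.single_le_sum (f := fun α => monom n α ^ 2) (fun _ _ => sq_nonneg _) h3
      have h5 : monom n (Pi.single j m) = (n j : ℝ) ^ m := by
        unfold monom
        rw [Finset.prod_eq_single j]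
        · simp
        · intro b _ hb; simp [hb]
        · simp
      simp only [h5] at h4
      rw [hj, pow_mul, sq_abs, ← pow_mul, mul_comm, pow_mul]
      exact h4
    calc br n ^ (2 * m) ≤ (2 * ‖n‖) ^ (2 * m) := by
          refine pow_le_pow_left₀ (zero_le_one.trans (one_le_br n)) ?_ _
          unfold br; linarith
      _ = 4 ^ m * ‖n‖ ^ (2 * m) := by rw [mul_pow, pow_mul]; norm_num
      _ ≤ _ := by gcongr

lemma one_le_freqSq {d : ℕ} {n : Fin d → ℤ} (hn : n ≠ 0) : 1 ≤ freqSq n := by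
  obtain ⟨j, hj⟩ := exists_norm_eq hn
  have h1 := one_le_norm hn
  have h2 := Finset.single_le_sum (f := fun j => (n j : ℝ) ^ 2) (fun _ _ => sq_nonneg _)
    (Finset.mem_univ j)
  rw [← sq_abs, ← hj] at h2
  unfold freqSq
  nlinarith

lemma br_sq_le_freqSq {d : ℕ} {n : Fin d → ℤ} (hn : n ≠ 0) : br n ^ 2 ≤ 4 * freqSq n := by
  obtain ⟨j, hj⟩ := exists_norm_eq hn
  have h1 := one_le_norm hn
  have h2 := Finset.single_le_sum (f := fun j => (n j : ℝ) ^ 2) (fun _ _ => sq_nonneg _)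
    (Finset.mem_univ j)
  rw [← sq_abs, ← hj] at h2
  unfold freqSq br
  nlinarith

lemma freqSq_le {d : ℕ} (n : Fin d → ℤ) : freqSq n ≤ d * br n ^ 2 := by
  have := Finset.sum_le_card_nsmul Finset.univ (fun j => (n j : ℝ) ^ 2) (br n ^ 2) fun j _ => by
    rw [← sq_abs]
    exact pow_le_pow_left₀ (abs_nonneg _) (abs_le_br n j) 2
  simpa [freqSq] using this

/-- One derivative costs at most a factor `|n|`. -/
lemma exists_weight_succ_le (d m : ℕ) : ∃ C : ℝ, 0 < C ∧ ∀ n : Fin d → ℤ, n ≠ 0 →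
    weight (m + 1) n ≤ C * freqSq n * weight m n := by
  refine ⟨((multiIndices d (m + 1)).card + 1) * (4 * 4 ^ m), by positivity, fun n hn => ?_⟩
  have h1 := weight_le (m + 1) n
  have h2 := br_pow_le_weight m n
  have h3 := br_sq_le_freqSq hn
  have h0 := zero_le_one.trans (one_le_br n)
  calc weight (m + 1) n ≤ (multiIndices d (m + 1)).card * br n ^ (2 * (m + 1)) := h1
    _ ≤ ((multiIndices d (m + 1)).card + 1) * (br n ^ 2 * br n ^ (2 * m)) := by
        rw [← pow_add, mul_add, mul_one, add_comm (2 * m)]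
        gcongr
        linarith
    _ ≤ ((multiIndices d (m + 1)).card + 1) * ((4 * freqSq n) * (4 ^ m * weight m n)) := by
        have := (sq_nonneg _).trans h3
        gcongr
    _ = _ := by ring

/-- A factor `|n|` is controlled by one derivative. -/
lemma exists_freqSq_mul_weight_le (d m : ℕ) : ∃ C : ℝ, 0 < C ∧ ∀ n : Fin d → ℤ,
    freqSq n * weight m n ≤ C * weight (m + 1) n := by
  refine ⟨(d * (multiIndices d m).card + 1) * 4 ^ (m + 1), by positivity, fun n => ?_⟩
  have h1 := weight_le m n
  have h2 := br_pow_le_weight (m + 1) n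
  have h3 := freqSq_le n
  have h0 := zero_le_one.trans (one_le_br n)
  calc freqSq n * weight m n ≤ (d * br n ^ 2) * ((multiIndices d m).card * br n ^ (2 * m)) := by
        refine mul_le_mul h3 h1 (weight_pos m n).le (by positivity)
    _ = (d * (multiIndices d m).card) * br n ^ (2 * (m + 1)) := by ring
    _ ≤ (d * (multiIndices d m).card + 1) * (4 ^ (m + 1) * weight (m + 1) n) := by
        gcongr
        linarith
    _ = _ := by ring

lemma weight_mono {d : ℕ} {m m' : ℕ} (h : m ≤ m') (n : Fin d → ℤ) : weight m n ≤ weight m' n :=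
  Finset.sum_le_sum_of_subset_of_nonneg
    (fun _ hα => mem_multiIndices.2 ((mem_multiIndices.1 hα).trans h)) fun _ _ _ => sq_nonneg _

/-- The lattice sum behind the Sobolev embedding of `H^s` for `s > d / 2`. -/
lemma summable_br_inv_pow {d p : ℕ} (hp : d < p) : Summable fun n : Fin d → ℤ => (br n)⁻¹ ^ p := by
  let b := Pi.basisFun ℝ (Fin d)
  let L := Submodule.span ℤ (range b)
  have hL : Module.finrank ℤ L = d := by
    rw [ZLattice.rank ℝ L, Module.finrank_fin_fun]
  have h1 := ZLattice.summable_norm_pow_inv L p (by rwa [hL])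
  have hmem : ∀ n : Fin d → ℤ, (fun i => (n i : ℝ)) ∈ L := by
    intro n
    rw [b.mem_span_iff_repr_mem ℤ]
    intro i
    exact ⟨n i, by simp [b]⟩
  let f : (Fin d → ℤ) → L := fun n => ⟨fun i => (n i : ℝ), hmem n⟩
  have hf : Function.Injective f := by
    intro n n' h
    have h := congr_arg Subtype.val h
    funext i
    have := congr_fun h i
    simp only [f] at this
    exact_mod_cast this
  have h2 := h1.comp_injective hf
  have h3 : ∀ n, ‖f n‖ = ‖n‖ := by
    intro n
    rw [← Submodule.norm_coe, Pi.norm_def, Pi.norm_def]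
    congr 2
  refine Summable.of_norm_bounded_eventually h2 ?_
  filter_upwards [(Set.finite_singleton (0 : Fin d → ℤ)).compl_mem_cofinite] with n hn
  have hn' := one_le_norm hn
  rw [Function.comp_apply, h3, norm_pow, norm_inv, Real.norm_of_nonneg
    (zero_le_one.trans (one_le_br n))]
  have h4 : 0 < ‖n‖ := by linarith
  have h5 : ‖n‖ ≤ br n := by unfold br; linarith
  exact pow_le_pow_left₀ (inv_nonneg.2 (h4.le.trans h5)) (inv_anti₀ h4 h5) p

/-! ### Convolution estimates -/

/-- Young's inequality `ℓ¹ * ℓ² → ℓ²`, in the form `(∑ₘ fₘ g_{n-m})² ≤ (∑ f) ∑ₘ fₘ g_{n-m}²`,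
summed over `n`. -/
lemma tsum_conv_sq_le {G : Type*} [AddCommGroup G] (f g : G → ENNReal) :
    ∑' n, (∑' m, f m * g (n - m)) ^ 2 ≤ (∑' m, f m) ^ 2 * ∑' n, g n ^ 2 := by
  have h1 : ∀ n, (∑' m, f m * g (n - m)) ^ 2 ≤ (∑' m, f m) * ∑' m, f m * g (n - m) ^ 2 := by
    intro n
    let _ : MeasurableSpace G := ⊤
    have h := ENNReal.lintegral_mul_le_Lp_mul_Lq (Measure.count : Measure G)
      (Real.HolderConjugate.two_two) (f := fun m => f m ^ (1 / 2 : ℝ))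
      (g := fun m => f m ^ (1 / 2 : ℝ) * g (n - m))
      (measurable_from_top.aemeasurable) (measurable_from_top.aemeasurable)
    have e1 : ∀ m, f m ^ (1 / 2 : ℝ) * (f m ^ (1 / 2 : ℝ) * g (n - m)) = f m * g (n - m) := by
      intro m
      rw [← mul_assoc, ← ENNReal.rpow_add_of_nonneg _ _ (by norm_num) (by norm_num)]
      norm_num
    have e2 : ∀ m, (f m ^ (1 / 2 : ℝ)) ^ (2 : ℝ) = f m := by
      intro m
      rw [← ENNReal.rpow_mul]
      norm_num
    simp only [Pi.mul_apply, lintegral_count, e1,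
      ENNReal.mul_rpow_of_nonneg _ _ (zero_le_two (α := ℝ)), e2] at h
    have h2 := pow_le_pow_left' h 2
    rw [mul_pow, ← ENNReal.rpow_natCast, ← ENNReal.rpow_natCast, ← ENNReal.rpow_natCast,
      ← ENNReal.rpow_mul, ← ENNReal.rpow_mul] at h2
    norm_num at h2
    exact h2
  calc ∑' n, (∑' m, f m * g (n - m)) ^ 2
      ≤ ∑' n, (∑' m, f m) * ∑' m, f m * g (n - m) ^ 2 := ENNReal.tsum_le_tsum h1
    _ = (∑' m, f m) * ∑' m, ∑' n, f m * g (n - m) ^ 2 := by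
        rw [ENNReal.tsum_mul_left, ENNReal.tsum_comm]
    _ = (∑' m, f m) * ∑' m, f m * ∑' n, g n ^ 2 := by
        congr 2
        funext m
        rw [ENNReal.tsum_mul_left]
        congr 1
        exact (Equiv.subRight m).tsum_eq fun n => g n ^ 2
    _ = _ := by rw [ENNReal.tsum_mul_right, ← mul_assoc, sq]

/-- The Cauchy–Schwarz inequality for sums in `[0, ∞]`. -/
lemma tsum_sq_le {ι : Type*} (f g : ι → ENNReal) :
    (∑' m, f m * g m) ^ 2 ≤ (∑' m, f m ^ 2) * ∑' m, g m ^ 2 := by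
  let _ : MeasurableSpace ι := ⊤
  have h := ENNReal.lintegral_mul_le_Lp_mul_Lq (Measure.count : Measure ι)
    (Real.HolderConjugate.two_two) (f := f) (g := g)
    (measurable_from_top.aemeasurable) (measurable_from_top.aemeasurable)
  simp only [Pi.mul_apply, lintegral_count] at h
  have h2 := pow_le_pow_left' h 2
  rw [mul_pow, ← ENNReal.rpow_natCast, ← ENNReal.rpow_natCast, ← ENNReal.rpow_natCast,
    ← ENNReal.rpow_mul, ← ENNReal.rpow_mul] at h2
  norm_num at h2
  exact_mod_cast h2

lemma ennreal_add_sq_le (a b : ENNReal) : (a + b) ^ 2 ≤ 2 * (a ^ 2 + b ^ 2) := by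
  wlog h : a ≤ b generalizing a b
  · rw [add_comm, add_comm (a ^ 2)]
    exact this b a (le_of_not_ge h)
  obtain ⟨c, rfl⟩ := exists_add_of_le h
  calc (a + (a + c)) ^ 2 ≤ (a + (a + c)) ^ 2 + c ^ 2 := le_self_add
    _ = _ := by ring

/-- A weight `q` with `q n ≤ K (q m + q (n - m))` and `∑ q⁻² < ∞` makes the weighted `ℓ²` space a
convolution algebra. -/
lemma tsum_weighted_conv_sq_le {G : Type*} [AddCommGroup G] {q : G → ENNReal} {K : ENNReal}
    (hq0 : ∀ n, q n ≠ 0) (hqt : ∀ n, q n ≠ ⊤) (hq : ∀ n m, q n ≤ K * (q m + q (n - m)))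
    (a b : G → ENNReal) :
    ∑' n, (q n * ∑' m, a m * b (n - m)) ^ 2 ≤
      4 * K ^ 2 * (∑' n, (q n)⁻¹ ^ 2) * (∑' n, (q n * a n) ^ 2) * ∑' n, (q n * b n) ^ 2 := by
  have hl1 : ∀ c : G → ENNReal, (∑' m, c m) ^ 2 ≤ (∑' n, (q n)⁻¹ ^ 2) * ∑' n, (q n * c n) ^ 2 := by
    intro c
    refine le_trans (le_of_eq ?_) (tsum_sq_le (fun n => (q n)⁻¹) fun n => q n * c n)
    congr 2
    funext n
    rw [← mul_assoc, ENNReal.inv_mul_cancel (hq0 n) (hqt n), one_mul]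
  have h1 : ∀ n, q n * ∑' m, a m * b (n - m) ≤
      K * ((∑' m, b m * (q (n - m) * a (n - m))) + ∑' m, a m * (q (n - m) * b (n - m))) := by
    intro n
    have e : ∑' m, b m * (q (n - m) * a (n - m)) = ∑' m, (q m * a m) * b (n - m) := by
      rw [← (Equiv.subLeft n).tsum_eq]
      congr 1
      funext m
      simp only [Equiv.subLeft_apply, sub_sub_cancel]
      ring
    rw [e, ← ENNReal.tsum_mul_left, ← ENNReal.tsum_add, ← ENNReal.tsum_mul_left]
    refine ENNReal.tsum_le_tsum fun m => ?_
    calc q n * (a m * b (n - m)) ≤ K * (q m + q (n - m)) * (a m * b (n - m)) := by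
          gcongr; exact hq n m
      _ = _ := by ring
  calc ∑' n, (q n * ∑' m, a m * b (n - m)) ^ 2
      ≤ ∑' n, K ^ 2 * (2 * ((∑' m, b m * (q (n - m) * a (n - m))) ^ 2 +
          (∑' m, a m * (q (n - m) * b (n - m))) ^ 2)) := by
        refine ENNReal.tsum_le_tsum fun n => (pow_le_pow_left' (h1 n) 2).trans ?_
        rw [mul_pow]
        gcongr
        exact ennreal_add_sq_le _ _
    _ = K ^ 2 * (2 * ((∑' n, (∑' m, b m * (q (n - m) * a (n - m))) ^ 2) +
          ∑' n, (∑' m, a m * (q (n - m) * b (n - m))) ^ 2)) := by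
        rw [ENNReal.tsum_mul_left, ENNReal.tsum_mul_left, ENNReal.tsum_add]
    _ ≤ K ^ 2 * (2 * (((∑' n, (q n)⁻¹ ^ 2) * ∑' n, (q n * b n) ^ 2) * (∑' n, (q n * a n) ^ 2) +
          ((∑' n, (q n)⁻¹ ^ 2) * ∑' n, (q n * a n) ^ 2) * ∑' n, (q n * b n) ^ 2)) := by
        gcongr
        · exact (tsum_conv_sq_le b fun n => q n * a n).trans (by gcongr; exact hl1 b)
        · exact (tsum_conv_sq_le a fun n => q n * b n).trans (by gcongr; exact hl1 a)
    _ = _ := by ring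

/-! ### Products of functions in terms of Hartley coefficients -/

/-- The squared weighted `ℓ²` norm `∑ₙ (1 + ‖n‖)^{2s} aₙ²`, with values in `[0, ∞]`. -/
noncomputable def esq {d : ℕ} (s : ℕ) (a : (Fin d → ℤ) → ℝ) : ENNReal :=
  ∑' n, (ENNReal.ofReal (br n) ^ s * ‖a n‖ₑ) ^ 2

lemma ofReal_br_pow_mul_enorm_sq {d : ℕ} (s : ℕ) (n : Fin d → ℤ) (x : ℝ) :
    (ENNReal.ofReal (br n) ^ s * ‖x‖ₑ) ^ 2 = ENNReal.ofReal (br n ^ (2 * s) * x ^ 2) := by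
  have h0 := zero_le_one.trans (one_le_br n)
  rw [Real.enorm_eq_ofReal_abs, ← ENNReal.ofReal_pow h0, ← ENNReal.ofReal_mul (by positivity),
    ← ENNReal.ofReal_pow (by positivity), mul_pow, sq_abs, ← pow_mul, mul_comm s]

lemma one_le_ofReal_br {d : ℕ} (n : Fin d → ℤ) : 1 ≤ ENNReal.ofReal (br n) := by
  rw [← ENNReal.ofReal_one]
  exact ENNReal.ofReal_le_ofReal (one_le_br n)

lemma esq_mono {d s s' : ℕ} (h : s ≤ s') (a : (Fin d → ℤ) → ℝ) : esq s a ≤ esq s' a := by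
  refine ENNReal.tsum_le_tsum fun n => ?_
  gcongr
  exact one_le_ofReal_br n

lemma hasSum_weight_mul_coef_sq_all {d m : ℕ} (u : H d m) :
    HasSum (fun n : Fin d → ℤ => weight m n * coef n u ^ 2) (‖u‖ ^ 2) := by
  refine (hasSum_subtype_iff_of_support_subset (s := {n | n ≠ 0}) ?_).1
    (hasSum_weight_mul_coef_sq u)
  intro n hn h0
  apply hn
  simp only
  rw [show n = 0 from h0, coef_zero]
  simp

lemma esq_coef_le {d m : ℕ} (u : H d m) :
    esq m (fun n => coef n u) ≤ ENNReal.ofReal (4 ^ m * ‖u‖ ^ 2) := by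
  have h := (hasSum_weight_mul_coef_sq_all u).mul_left (4 ^ m)
  rw [← h.tsum_eq, ENNReal.ofReal_tsum_of_nonneg _ h.summable]
  · refine ENNReal.tsum_le_tsum fun n => ?_
    rw [ofReal_br_pow_mul_enorm_sq, ← mul_assoc]
    exact ENNReal.ofReal_le_ofReal
      (mul_le_mul_of_nonneg_right (br_pow_le_weight m n) (sq_nonneg _))
  · intro n
    have := weight_pos m n
    positivity

lemma esq_dx_le {d m : ℕ} (j : Fin d) (u : H d (m + 1)) :
    esq m (fun n => inner ℝ (hart 0 n) (dx j u)) ≤ ENNReal.ofReal (4 ^ (m + 1) * ‖u‖ ^ 2) := by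
  refine le_trans ?_ (esq_coef_le u)
  unfold esq
  rw [← (Equiv.neg _).tsum_eq]
  refine ENNReal.tsum_le_tsum fun n => ?_
  simp only [ofReal_br_pow_mul_enorm_sq, inner_hart_dx, Equiv.neg_apply, neg_neg, br_neg,
    Pi.neg_apply, Int.cast_neg]
  refine ENNReal.ofReal_le_ofReal ?_
  have h1 := pow_le_pow_left₀ (abs_nonneg _) (abs_le_br n j) 2
  rw [sq_abs] at h1
  have h0 := zero_le_one.trans (one_le_br n)
  calc br n ^ (2 * m) * (n j * coef n u) ^ 2 = br n ^ (2 * m) * (n j : ℝ) ^ 2 * coef n u ^ 2 := by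
        ring
    _ ≤ br n ^ (2 * m) * br n ^ 2 * coef n u ^ 2 := by gcongr
    _ = _ := by ring

/-- Riesz–Fischer with a norm bound. -/
lemma exists_coef_eq_of_esq_le {d m : ℕ} {a : (Fin d → ℤ) → ℝ} {B : ℝ} (hB : 0 ≤ B)
    (h : esq m a ≤ ENNReal.ofReal B) :
    ∃ u : H d m, (∀ n, n ≠ 0 → coef n u = a n) ∧
      ‖u‖ ^ 2 ≤ (multiIndices d m).card * B := by
  have h0 : ∀ n, 0 ≤ weight m n * a n ^ 2 := fun n => by
    have := weight_pos m n
    positivity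
  have h1 : ∑' n, ENNReal.ofReal (weight m n * a n ^ 2) ≤
      ENNReal.ofReal ((multiIndices d m).card * B) := by
    rw [ENNReal.ofReal_mul (by positivity)]
    refine le_trans ?_ (mul_le_mul_right h _)
    unfold esq
    rw [← ENNReal.tsum_mul_left]
    refine ENNReal.tsum_le_tsum fun n => ?_
    rw [ofReal_br_pow_mul_enorm_sq, ← ENNReal.ofReal_mul (by positivity), ← mul_assoc]
    exact ENNReal.ofReal_le_ofReal (mul_le_mul_of_nonneg_right (weight_le m n) (sq_nonneg _))
  have h2 : Summable fun n => weight m n * a n ^ 2 := by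
    have := ENNReal.summable_toReal (h1.trans_lt ENNReal.ofReal_lt_top).ne
    exact this.congr fun n => ENNReal.toReal_ofReal (h0 n)
  obtain ⟨u, hu⟩ := exists_coef_eq (a := fun n => a n.1) (h2.subtype {n | n ≠ 0})
  refine ⟨u, fun n hn => hu ⟨n, hn⟩, ?_⟩
  rw [← ENNReal.ofReal_tsum_of_nonneg h0 h2, ENNReal.ofReal_le_ofReal_iff (by positivity)] at h1
  refine le_trans ?_ h1
  have h3 := hasSum_weight_mul_coef_sq u
  simp only [hu] at h3
  rw [← h3.tsum_eq]
  exact h2.tsum_subtype_le _ {n | n ≠ 0} h0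

/-- The integral of `u w` against a wave: up to normalization, a Hartley coefficient of the product
`u w`. -/
noncomputable def tri {d : ℕ} (n : Fin d → ℤ) (u w : L2 d) : ℝ :=
  ∫ x, u x * (w x * wave 0 n x)

lemma memLp_mul_wave {d : ℕ} (n : Fin d → ℤ) (w : L2 d) :
    MemLp (fun x => w x * wave 0 n x) 2 (volume : Measure (Torus d)) := by
  refine ((Lp.memLp w).const_mul 2).mono
    ((Lp.aestronglyMeasurable w).mul (waveTest 0 n).continuous.aestronglyMeasurable) ?_
  refine Filter.Eventually.of_forall fun x => ?_
  have := abs_wave_le 0 n x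
  simp only [norm_mul, Real.norm_eq_abs, Nat.abs_ofNat]
  nlinarith [abs_nonneg (w x)]

lemma integrable_tri {d : ℕ} (n : Fin d → ℤ) (u w : L2 d) :
    Integrable fun x => u x * (w x * wave 0 n x) :=
  (Lp.memLp u).integrable_mul (memLp_mul_wave n w)

/-- By Parseval and the product formula, the coefficients of a product are sums of convolutions of
the coefficients of the factors and their reflections. -/
lemma hasSum_tri {d : ℕ} (n : Fin d → ℤ) (u w : L2 d) :
    HasSum (fun m => inner ℝ (hart 0 m) u *
      ((inner ℝ (hart 0 (m - n)) w + inner ℝ (hart 0 (n - m)) w + inner ℝ (hart 0 (m + n)) w -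
        inner ℝ (hart 0 (-m - n)) w) / 2)) (tri n u w) := by
  have h := hasSum_inner_hart_mul u (memLp_mul_wave n w).toLp
  have h1 : inner ℝ u (memLp_mul_wave n w).toLp = tri n u w := by
    rw [L2.inner_def]
    refine integral_congr_ae ?_
    filter_upwards [(memLp_mul_wave n w).coeFn_toLp] with x hx
    rw [hx]
    exact mul_comm _ _
  rw [h1] at h
  refine h.congr_fun fun m => ?_
  congr 1
  simp only [inner_hart]
  have hi : ∀ p : Fin d → ℤ, Integrable fun x => w x * (waveTest 0 p).toFun x := fun p =>
    (Lp.memLp w).integrable_mul (waveTest 0 p).memLp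
  have h2 : pairing (memLp_mul_wave n w).toLp (waveTest 0 m) =
      ∫ x, (w x * (waveTest 0 (m - n)).toFun x + w x * (waveTest 0 (n - m)).toFun x +
        w x * (waveTest 0 (m + n)).toFun x - w x * (waveTest 0 (-m - n)).toFun x) / 2 := by
    refine integral_congr_ae ?_
    filter_upwards [(memLp_mul_wave n w).coeFn_toLp] with x hx
    rw [hx]
    have := wave_zero_mul_wave_zero m n x
    simp only [waveTest]
    linear_combination w x * this
  rw [h2, integral_div, integral_sub (((hi _).fun_add (hi _)).fun_add (hi _)) (hi _),
    integral_add ((hi _).fun_add (hi _)) (hi _), integral_add (hi _) (hi _)]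
  simp only [pairing]
  ring

lemma enorm_tri_le {d : ℕ} (n : Fin d → ℤ) (u w : L2 d) :
    ‖tri n u w‖ₑ ≤ ∑' m, (‖inner ℝ (hart 0 m) u‖ₑ + ‖inner ℝ (hart 0 (-m)) u‖ₑ) *
      (‖inner ℝ (hart 0 (n - m)) w‖ₑ + ‖inner ℝ (hart 0 (-(n - m))) w‖ₑ) := by
  set a : (Fin d → ℤ) → ENNReal := fun m => ‖inner ℝ (hart 0 m) u‖ₑ
  set b : (Fin d → ℤ) → ENNReal := fun m => ‖inner ℝ (hart 0 m) w‖ₑ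
  have h1 : ‖tri n u w‖ₑ ≤ ∑' m, (a m * (b (n - m) + b (-(n - m))) +
      a m * (b (n + m) + b (-(n + m)))) := by
    rw [← (hasSum_tri n u w).tsum_eq]
    refine enorm_tsum_le_tsum_enorm.trans (ENNReal.tsum_le_tsum fun m => ?_)
    rw [enorm_mul, ← mul_add]
    gcongr
    rw [neg_sub, add_comm n m, neg_add', div_eq_mul_inv, enorm_mul]
    have h2 : ‖(2⁻¹ : ℝ)‖ₑ ≤ 1 := by
      rw [Real.enorm_eq_ofReal_abs, ← ENNReal.ofReal_one]
      exact ENNReal.ofReal_le_ofReal (by rw [abs_of_pos] <;> norm_num)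
    refine (mul_le_mul_right h2 _).trans ?_
    rw [mul_one]
    refine enorm_sub_le.trans ?_
    rw [add_comm (b (n - m)), ← add_assoc]
    gcongr
    refine (enorm_add_le _ _).trans ?_
    gcongr
    exact enorm_add_le _ _
  refine h1.trans (le_of_eq ?_)
  rw [ENNReal.tsum_add, ← (Equiv.neg _).tsum_eq fun m => a m * (b (n + m) + b (-(n + m))),
    ← ENNReal.tsum_add]
  refine tsum_congr fun m => ?_
  simp only [Equiv.neg_apply, ← sub_eq_add_neg, ← add_mul, a, b]

lemma ofReal_br_pow_le {d : ℕ} (s : ℕ) (n m : Fin d → ℤ) :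
    ENNReal.ofReal (br n) ^ s ≤
      2 ^ s * (ENNReal.ofReal (br m) ^ s + ENNReal.ofReal (br (n - m)) ^ s) := by
  have h1 : ENNReal.ofReal (br n) ≤ ENNReal.ofReal (br m) + ENNReal.ofReal (br (n - m)) := by
    rw [← ENNReal.ofReal_add (zero_le_one.trans (one_le_br _)) (zero_le_one.trans (one_le_br _))]
    refine ENNReal.ofReal_le_ofReal ?_
    have := norm_add_le m (n - m)
    rw [add_sub_cancel] at this
    unfold br; linarith
  have h2 : ∀ x y : ENNReal, x ≤ y → (x + y) ^ s ≤ 2 ^ s * (x ^ s + y ^ s) := by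
    intro x y h
    calc (x + y) ^ s ≤ (2 * y) ^ s := by rw [two_mul]; gcongr
      _ = 2 ^ s * y ^ s := mul_pow _ _ _
      _ ≤ _ := by gcongr; exact le_add_self
  refine (pow_le_pow_left' h1 s).trans ?_
  rcases le_total (ENNReal.ofReal (br m)) (ENNReal.ofReal (br (n - m))) with h | h
  · exact h2 _ _ h
  · rw [add_comm, add_comm (_ ^ s)]
    exact h2 _ _ h

lemma tsum_inv_br_ne_top {d s : ℕ} (hs : d < 2 * s) :
    ∑' n : Fin d → ℤ, (ENNReal.ofReal (br n) ^ s)⁻¹ ^ 2 ≠ ⊤ := by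
  have h := (summable_br_inv_pow hs).tsum_ofReal_ne_top
  convert h using 3 with n
  have h0 : 0 < br n := zero_lt_one.trans_le (one_le_br n)
  rw [← ENNReal.ofReal_pow h0.le, ← ENNReal.ofReal_inv_of_pos (by positivity),
    ← ENNReal.ofReal_pow (by positivity), mul_comm 2 s, pow_mul]
  simp only [inv_pow]

/-- The algebra property of `H^s`, `s > d / 2`, in terms of coefficients. -/
lemma exists_esq_tri_le {d s : ℕ} (hs : d < 2 * s) : ∃ C : ENNReal, C ≠ ⊤ ∧ ∀ u w : L2 d,
    esq s (fun n => tri n u w) ≤ C * esq s (fun n => inner ℝ (hart 0 n) u) *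
      esq s (fun n => inner ℝ (hart 0 n) w) := by
  refine ⟨4 * (2 ^ s) ^ 2 * (∑' n : Fin d → ℤ, (ENNReal.ofReal (br n) ^ s)⁻¹ ^ 2) * 4 * 4, ?_,
    fun u w => ?_⟩
  · have := tsum_inv_br_ne_top hs
    finiteness
  have hsym : ∀ c : (Fin d → ℤ) → ℝ,
      ∑' n, (ENNReal.ofReal (br n) ^ s * (‖c n‖ₑ + ‖c (-n)‖ₑ)) ^ 2 ≤ 4 * esq s c := by
    intro c
    calc ∑' n, (ENNReal.ofReal (br n) ^ s * (‖c n‖ₑ + ‖c (-n)‖ₑ)) ^ 2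
        ≤ ∑' n, 2 * ((ENNReal.ofReal (br n) ^ s * ‖c n‖ₑ) ^ 2 +
          (ENNReal.ofReal (br (-n)) ^ s * ‖c (-n)‖ₑ) ^ 2) := by
          refine ENNReal.tsum_le_tsum fun n => ?_
          rw [mul_add, br_neg]
          exact ennreal_add_sq_le _ _
      _ = 2 * (esq s c + esq s c) := by
          rw [ENNReal.tsum_mul_left, ENNReal.tsum_add]
          congr 2
          exact (Equiv.neg _).tsum_eq fun n => (ENNReal.ofReal (br n) ^ s * ‖c n‖ₑ) ^ 2
      _ = _ := by ring
  have h1 := tsum_weighted_conv_sq_le (q := fun n : Fin d → ℤ => ENNReal.ofReal (br n) ^ s)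
    (K := 2 ^ s)
    (fun n => pow_ne_zero _ (zero_lt_one.trans_le (one_le_ofReal_br n)).ne')
    (fun n => by finiteness) (fun n m => ofReal_br_pow_le s n m)
    (fun m => ‖inner ℝ (hart 0 m) u‖ₑ + ‖inner ℝ (hart 0 (-m)) u‖ₑ)
    (fun m => ‖inner ℝ (hart 0 m) w‖ₑ + ‖inner ℝ (hart 0 (-m)) w‖ₑ)
  calc esq s (fun n => tri n u w) ≤ _ := by
        refine ENNReal.tsum_le_tsum fun n => ?_
        exact pow_le_pow_left' (mul_le_mul_right (enorm_tri_le n u w) _) 2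
    _ ≤ _ := h1
    _ ≤ 4 * (2 ^ s) ^ 2 * (∑' n : Fin d → ℤ, (ENNReal.ofReal (br n) ^ s)⁻¹ ^ 2) *
        (4 * esq s (fun n => inner ℝ (hart 0 n) u)) *
        (4 * esq s (fun n => inner ℝ (hart 0 n) w)) := by
        gcongr
        · exact hsym fun n => inner ℝ (hart 0 n) u
        · exact hsym fun n => inner ℝ (hart 0 n) w
    _ = _ := by ring

/-- The Sobolev embedding `H^m ⊆ L^∞`, `m > d / 2`: the Hartley series converges uniformly. -/
lemma exists_ae_bound {d m : ℕ} (hm : d < 2 * m) (u : H d m) : ∃ C, ∀ᵐ x, |toL2 u x| ≤ C := by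
  have h1 : ∑' n, ‖coef n u‖ₑ ≠ ⊤ := by
    have h2 := tsum_sq_le (fun n : Fin d → ℤ => (ENNReal.ofReal (br n) ^ m)⁻¹)
      (fun n => ENNReal.ofReal (br n) ^ m * ‖coef n u‖ₑ)
    have h3 : ∀ n, (ENNReal.ofReal (br n) ^ m)⁻¹ * (ENNReal.ofReal (br n) ^ m * ‖coef n u‖ₑ) =
        ‖coef n u‖ₑ := by
      intro n
      rw [← mul_assoc, ENNReal.inv_mul_cancel
        (pow_ne_zero _ (zero_lt_one.trans_le (one_le_ofReal_br n)).ne') (by finiteness), one_mul]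
    simp only [h3] at h2
    intro h
    rw [h] at h2
    have h4 := tsum_inv_br_ne_top hm
    have h5 := ((esq_coef_le u).trans_lt ENNReal.ofReal_lt_top).ne
    exact (ENNReal.mul_ne_top h4 h5) (top_le_iff.1 (by simpa [esq] using h2))
  have h2 : Summable fun n => |coef n u| := by
    refine (ENNReal.summable_toReal h1).congr fun n => ?_
    rw [toReal_enorm, Real.norm_eq_abs]
  have h3 : Summable fun n => (coef n u * (√(mass d))⁻¹) • waveCont n := by
    refine Summable.of_norm_bounded (h2.mul_right (|(√(mass d))⁻¹| * 2)) fun n => ?_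
    rw [norm_smul, Real.norm_eq_abs, abs_mul, mul_assoc]
    gcongr
    rw [ContinuousMap.norm_le _ (by norm_num)]
    exact fun x => abs_wave_le 0 n x
  obtain ⟨S, hS⟩ := h3
  have h4 := hS.mapL (ContinuousMap.toLp 2 (volume : Measure (Torus d)) ℝ)
  have h5 := (hartBasis d).hasSum_repr (toL2 u)
  have h6 : toL2 u = ContinuousMap.toLp 2 (volume : Measure (Torus d)) ℝ S := by
    refine h5.unique (h4.congr_fun fun n => ?_)
    rw [HilbertBasis.repr_apply_apply, coe_hartBasis, ← coef_apply, map_smul, hart, smul_smul]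
    rfl
  refine ⟨‖S‖, ?_⟩
  filter_upwards [ContinuousMap.coeFn_toLp (p := 2) (𝕜 := ℝ) volume S] with x hx
  rw [h6, hx]
  exact S.norm_coe_le_norm x

/-! ### The advection term -/

-- Shortcuts for instances of subspaces of `ℓ²`-products, whose inference is slow.
noncomputable scoped instance (d m : ℕ) : NormedAddCommGroup (H d m) := inferInstance

noncomputable scoped instance (d m : ℕ) : NormedSpace ℝ (H d m) := inferInstance

noncomputable scoped instance (d m : ℕ) : NormedAddCommGroup (HSigma d m) := inferInstance

noncomputable scoped instance (d m : ℕ) : NormedSpace ℝ (HSigma d m) := inferInstance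

/-- The function `v · ∇φ`. -/
noncomputable def advFun {d k : ℕ} (v : HSigma d (k + 2)) (φ : H d (k + 2)) (x : Torus d) : ℝ :=
  ∑ j, toL2 (v.1 j) x * dx j φ x

lemma memLp_advFun {d k : ℕ} (hk : d < 2 * (k + 1)) (v : HSigma d (k + 2)) (φ : H d (k + 2)) :
    MemLp (advFun v φ) 2 (volume : Measure (Torus d)) := by
  refine memLp_finsetSum _ fun j _ => ?_
  obtain ⟨C, hC⟩ := exists_ae_bound (by omega) (v.1 j)
  refine ((Lp.memLp (dx j φ)).const_mul C).mono
    ((Lp.aestronglyMeasurable _).mul (Lp.aestronglyMeasurable _)) ?_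
  filter_upwards [hC] with x hx
  rw [norm_mul, norm_mul]
  gcongr
  exact hx.trans (le_abs_self C)

lemma inner_hart_advFun {d k : ℕ} (hk : d < 2 * (k + 1)) (v : HSigma d (k + 2))
    (φ : H d (k + 2)) (n : Fin d → ℤ) :
    inner ℝ (hart 0 n) (memLp_advFun hk v φ).toLp =
      (√(mass d))⁻¹ * ∑ j, tri n (toL2 (v.1 j)) (dx j φ) := by
  rw [inner_hart]
  congr 1
  unfold tri pairing
  rw [← integral_finsetSum _ fun j _ => integrable_tri _ _ _]
  refine integral_congr_ae ?_
  filter_upwards [(memLp_advFun hk v φ).coeFn_toLp] with x hx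
  rw [hx, advFun, Finset.sum_mul]
  exact Finset.sum_congr rfl fun j _ => mul_assoc _ _ _

/-- The divergence of `v` vanishes at each frequency. -/
lemma sum_mul_coef_eq_zero {d k : ℕ} (v : HSigma d k) (n : Fin d → ℤ) :
    ∑ j, (n j : ℝ) * coef n (v.1 j) = 0 := by
  -- As `cas⁽⁴⁾ = cas`, the partial derivatives of the wave `cas‴(n · x)` are multiples of
  -- `cas(n · x)`.
  have h := v.2 (waveTest 3 n)
  have h1 : ∀ j, pairing (toL2 (v.1 j)) ((waveTest 3 n).partial j) =
      n j * pairing (toL2 (v.1 j)) (waveTest 0 n) := by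
    intro j
    unfold pairing
    rw [← integral_const_mul]
    refine integral_congr_ae (Filter.Eventually.of_forall fun x => ?_)
    have h2 := wave_two_mul 2 n x
    have h3 := congr_fun (partialFun_wave j 3 n) x
    simp only [TestFunction.partial, waveTest]
    rw [h3, h2]
    ring
  simp only [h1] at h
  simp only [coef_apply, inner_hart]
  calc ∑ j, (n j : ℝ) * ((√(mass d))⁻¹ * pairing (toL2 (v.1 j)) (waveTest 0 n))
      = (√(mass d))⁻¹ * ∑ j, (n j : ℝ) * pairing (toL2 (v.1 j)) (waveTest 0 n) := by
        rw [Finset.mul_sum]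
        exact Finset.sum_congr rfl fun j _ => by ring
    _ = 0 := by rw [h, mul_zero]

/-- Since `v` is divergence free, `v · ∇φ` has mean zero. -/
lemma sum_tri_zero {d k : ℕ} (v : HSigma d (k + 2)) (φ : H d (k + 2)) :
    ∑ j, tri 0 (toL2 (v.1 j)) (dx j φ) = 0 := by
  have h1 : ∀ j, tri 0 (toL2 (v.1 j)) (dx j φ) = inner ℝ (toL2 (v.1 j)) (dx j φ) := by
    intro j
    rw [L2.inner_def]
    refine integral_congr_ae (Filter.Eventually.of_forall fun x => ?_)
    simp only [wave_zero_zero, mul_one]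
    exact mul_comm _ _
  have h2 := hasSum_sum fun j (_ : j ∈ Finset.univ) =>
    hasSum_inner_hart_mul (toL2 (v.1 j)) (dx j φ)
  rw [Finset.sum_congr rfl fun j _ => h1 j]
  refine h2.unique ?_
  convert hasSum_zero with n
  have h3 := sum_mul_coef_eq_zero v n
  simp only [inner_hart_dx, ← coef_apply]
  calc ∑ j, coef n (v.1 j) * (-n j * coef (-n) φ)
      = -coef (-n) φ * ∑ j, (n j : ℝ) * coef n (v.1 j) := by
        rw [Finset.mul_sum]
        exact Finset.sum_congr rfl fun j _ => by ring
    _ = 0 := by rw [h3, mul_zero]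

lemma HSigma_norm_sq {d k : ℕ} (v : HSigma d k) : ‖v‖ ^ 2 = ∑ j, ‖v.1 j‖ ^ 2 := by
  rw [← Submodule.norm_coe, PiLp.norm_sq_eq_of_L2]

/-- `v · ∇φ` belongs to `H^{k+1}`, by the algebra property. -/
lemma exists_advFun_eq {d k : ℕ} (hk : d < 2 * (k + 1)) : ∃ K : ℝ, ∀ (v : HSigma d (k + 2))
    (φ : H d (k + 2)), ∃ u : H d (k + 1), toL2 u =ᵐ[volume] advFun v φ ∧ ‖u‖ ≤ K * ‖v‖ * ‖φ‖ := by
  obtain ⟨C, hCt, hC⟩ := exists_esq_tri_le hk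
  set c : ℝ := (√(mass d))⁻¹
  set B : ℝ := c ^ 2 * d * C.toReal * (4 ^ (k + 2) * 4 ^ (k + 2))
  have hB : 0 ≤ B := by positivity
  refine ⟨√((multiIndices d (k + 1)).card * B), fun v φ => ?_⟩
  set W := (memLp_advFun hk v φ).toLp
  have hj : ∀ j, esq (k + 1) (fun n => tri n (toL2 (v.1 j)) (dx j φ)) ≤
      ENNReal.ofReal (C.toReal * (4 ^ (k + 2) * ‖v.1 j‖ ^ 2) * (4 ^ (k + 2) * ‖φ‖ ^ 2)) := by
    intro j
    refine (hC _ _).trans ?_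
    rw [ENNReal.ofReal_mul (by positivity), ENNReal.ofReal_mul (by positivity),
      ENNReal.ofReal_toReal hCt]
    gcongr
    · exact (esq_mono (Nat.le_succ (k + 1)) _).trans (esq_coef_le (v.1 j))
    · exact esq_dx_le j φ
  have hG : esq (k + 1) (fun n => inner ℝ (hart 0 n) W) ≤
      ENNReal.ofReal (B * (‖v‖ ^ 2 * ‖φ‖ ^ 2)) := by
    calc esq (k + 1) (fun n => inner ℝ (hart 0 n) W)
        ≤ ∑' n, ENNReal.ofReal (c ^ 2 * d) * ∑ j,
            (ENNReal.ofReal (br n) ^ (k + 1) * ‖tri n (toL2 (v.1 j)) (dx j φ)‖ₑ) ^ 2 := by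
          refine ENNReal.tsum_le_tsum fun n => ?_
          simp only [ofReal_br_pow_mul_enorm_sq]
          rw [← ENNReal.ofReal_sum_of_nonneg fun j _ => by
            have := one_le_br n
            positivity]
          rw [← ENNReal.ofReal_mul (by positivity)]
          refine ENNReal.ofReal_le_ofReal ?_
          rw [inner_hart_advFun hk, ← Finset.mul_sum, mul_pow]
          have h1 := sq_sum_le_card_mul_sum_sq (s := Finset.univ)
            (f := fun j => tri n (toL2 (v.1 j)) (dx j φ))
          rw [Finset.card_univ, Fintype.card_fin] at h1
          have h2 : 0 ≤ br n ^ (2 * (k + 1)) := by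
            have := one_le_br n
            positivity
          calc br n ^ (2 * (k + 1)) * (c ^ 2 * (∑ j, tri n (toL2 (v.1 j)) (dx j φ)) ^ 2)
              ≤ br n ^ (2 * (k + 1)) * (c ^ 2 * (d * ∑ j, tri n (toL2 (v.1 j)) (dx j φ) ^ 2)) := by
                gcongr
            _ = _ := by ring
      _ = ENNReal.ofReal (c ^ 2 * d) * ∑ j,
            esq (k + 1) (fun n => tri n (toL2 (v.1 j)) (dx j φ)) := by
          rw [ENNReal.tsum_mul_left, Summable.tsum_finsetSum fun _ _ => ENNReal.summable]
          rfl
      _ ≤ ENNReal.ofReal (c ^ 2 * d) * ∑ j,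
            ENNReal.ofReal (C.toReal * (4 ^ (k + 2) * ‖v.1 j‖ ^ 2) * (4 ^ (k + 2) * ‖φ‖ ^ 2)) := by
          gcongr with j
          exact hj j
      _ = _ := by
          rw [← ENNReal.ofReal_sum_of_nonneg fun j _ => by positivity,
            ← ENNReal.ofReal_mul (by positivity), HSigma_norm_sq]
          congr 1
          rw [← Finset.sum_mul, ← Finset.mul_sum, ← Finset.mul_sum]
          ring
  obtain ⟨u, hu, hun⟩ := exists_coef_eq_of_esq_le (by positivity) hG
  refine ⟨u, ?_, ?_⟩
  · have : toL2 u = W := by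
      refine toL2_ext fun n => ?_
      by_cases hn : n = 0
      · rw [hn, ← coef_apply, coef_zero, inner_hart_advFun hk, sum_tri_zero, mul_zero]
      · exact hu n hn
    rw [this]
    exact (memLp_advFun hk v φ).coeFn_toLp
  · refine abs_le_of_sq_le_sq' ?_ (by positivity) |>.2
    rw [mul_pow, mul_pow, Real.sq_sqrt (by positivity)]
    calc ‖u‖ ^ 2 ≤ _ := hun
      _ = _ := by ring

lemma toL2_ae_add {d m : ℕ} (u w : H d m) : toL2 (u + w) =ᵐ[volume] fun x => toL2 u x + toL2 w x :=
  Lp.coeFn_add (toL2 u) (toL2 w)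

lemma toL2_ae_smul {d m : ℕ} (c : ℝ) (u : H d m) :
    toL2 (c • u) =ᵐ[volume] fun x => c * toL2 u x :=
  Lp.coeFn_smul c (toL2 u)

lemma exists_bilinear {E F G : Type*} [NormedAddCommGroup E] [NormedSpace ℝ E]
    [NormedAddCommGroup F] [NormedSpace ℝ F] [NormedAddCommGroup G] [NormedSpace ℝ G]
    (N : E → F → G) (h1 : ∀ v v' φ, N (v + v') φ = N v φ + N v' φ)
    (h2 : ∀ (c : ℝ) v φ, N (c • v) φ = c • N v φ) (h3 : ∀ v φ φ', N v (φ + φ') = N v φ + N v φ')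
    (h4 : ∀ (c : ℝ) v φ, N v (c • φ) = c • N v φ) (K : ℝ) (hK : ∀ v φ, ‖N v φ‖ ≤ K * ‖v‖ * ‖φ‖) :
    ∃ B : E →L[ℝ] F →L[ℝ] G, ∀ v φ, B v φ = N v φ :=
  ⟨LinearMap.mkContinuous₂ (LinearMap.mk₂ ℝ N h1 h2 h3 h4) K hK, fun _ _ => rfl⟩

set_option synthInstance.maxHeartbeats 400000 in
/-- The advection term `(v, φ) ↦ v · ∇φ` is a bounded bilinear map into `H^{k+1}`. -/
lemma exists_advection {d k : ℕ} (hk : d < 2 * (k + 1)) :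
    ∃ N : HSigma d (k + 2) →L[ℝ] H d (k + 2) →L[ℝ] H d (k + 1),
      ∀ v φ, toL2 (N v φ) =ᵐ[volume] advFun v φ := by
  obtain ⟨K, hK⟩ := exists_advFun_eq hk
  choose N hN hNn using hK
  have hext : ∀ u w : H d (k + 1), toL2 u =ᵐ[volume] toL2 w → u = w := fun u w h => H_ext (Lp.ext h)
  suffices h : ∃ B : HSigma d (k + 2) →L[ℝ] H d (k + 2) →L[ℝ] H d (k + 1), ∀ v φ, B v φ = N v φ by
    obtain ⟨B, hB⟩ := h
    exact ⟨B, fun v φ => by rw [hB]; exact hN v φ⟩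
  refine exists_bilinear N ?_ ?_ ?_ ?_ K hNn
  · intro v v' φ
    apply hext
    have h1 : ∀ᵐ x : Torus d, ∀ j, toL2 ((v + v').1 j) x = toL2 (v.1 j) x + toL2 (v'.1 j) x :=
      ae_all_iff.2 fun j => toL2_ae_add (v.1 j) (v'.1 j)
    filter_upwards [hN (v + v') φ, hN v φ, hN v' φ, toL2_ae_add (N v φ) (N v' φ), h1]
      with x e1 e2 e3 e4 e5
    rw [e1, e4, e2, e3]
    simp only [advFun, e5, add_mul, Finset.sum_add_distrib]
  · intro c v φ
    apply hext
    have h1 : ∀ᵐ x : Torus d, ∀ j, toL2 ((c • v).1 j) x = c * toL2 (v.1 j) x :=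
      ae_all_iff.2 fun j => toL2_ae_smul c (v.1 j)
    filter_upwards [hN (c • v) φ, hN v φ, toL2_ae_smul c (N v φ), h1] with x e1 e2 e4 e5
    rw [e1, e4, e2]
    simp only [advFun, e5, mul_assoc, Finset.mul_sum]
  · intro v φ φ'
    apply hext
    have h1 : ∀ᵐ x : Torus d, ∀ j, dx j (φ + φ') x = dx j φ x + dx j φ' x :=
      ae_all_iff.2 fun j => Lp.coeFn_add (dx j φ) (dx j φ')
    filter_upwards [hN v (φ + φ'), hN v φ, hN v φ', toL2_ae_add (N v φ) (N v φ'), h1]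
      with x e1 e2 e3 e4 e5
    rw [e1, e4, e2, e3]
    simp only [advFun, e5, mul_add, Finset.sum_add_distrib]
  · intro c v φ
    apply hext
    have h1 : ∀ᵐ x : Torus d, ∀ j, dx j (c • φ) x = c * dx j φ x :=
      ae_all_iff.2 fun j => Lp.coeFn_smul c (dx j φ)
    filter_upwards [hN v (c • φ), hN v φ, toL2_ae_smul c (N v φ), h1] with x e1 e2 e4 e5
    rw [e1, e4, e2]
    simp only [advFun, e5, Finset.mul_sum]
    exact Finset.sum_congr rfl fun j _ => by ring

/-! ### The scalar equation `y' = -l y + F` -/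

/-- The solution of `y' = -l y + F`, `y(0) = a`, by Duhamel's formula. -/
noncomputable def duhamel (l a : ℝ) (F : ℝ → ℝ) (t : ℝ) : ℝ :=
  Real.exp (-(l * t)) * (a + ∫ s in (0 : ℝ)..t, Real.exp (l * s) * F s)

lemma duhamel_zero (l a : ℝ) (F : ℝ → ℝ) : duhamel l a F 0 = a := by
  simp [duhamel]

lemma hasDerivAt_duhamel (l a : ℝ) {F : ℝ → ℝ} (hF : Continuous F) (t : ℝ) :
    HasDerivAt (duhamel l a F) (-(l * duhamel l a F t) + F t) t := by
  have hc : Continuous fun s => Real.exp (l * s) * F s := by fun_prop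
  have h1 : HasDerivAt (fun t : ℝ => Real.exp (-(l * t))) (Real.exp (-(l * t)) * -l) t := by
    have := (((hasDerivAt_id t).const_mul l).fun_neg).exp
    simpa using this
  have h2 : HasDerivAt (fun t => a + ∫ s in (0 : ℝ)..t, Real.exp (l * s) * F s)
      (Real.exp (l * t) * F t) t :=
    (hc.integral_hasStrictDerivAt 0 t).hasDerivAt.const_add a
  have h3 : Real.exp (-(l * t)) * Real.exp (l * t) = 1 := by
    rw [← Real.exp_add, neg_add_cancel, Real.exp_zero]
  refine (h1.mul h2).congr_deriv ?_
  unfold duhamel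
  linear_combination F t * h3

lemma continuous_duhamel (l a : ℝ) {F : ℝ → ℝ} (hF : Continuous F) :
    Continuous (duhamel l a F) :=
  continuous_iff_continuousAt.2 fun t => (hasDerivAt_duhamel l a hF t).continuousAt

lemma duhamel_sub (l a a' : ℝ) {F F' : ℝ → ℝ} (hF : Continuous F) (hF' : Continuous F') (t : ℝ) :
    duhamel l a F t - duhamel l a' F' t = duhamel l (a - a') (fun s => F s - F' s) t := by
  have hc : Continuous fun s => Real.exp (l * s) * F s := by fun_prop
  have hc' : Continuous fun s => Real.exp (l * s) * F' s := by fun_prop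
  unfold duhamel
  simp only [mul_sub]
  rw [intervalIntegral.integral_sub (hc.intervalIntegrable _ _) (hc'.intervalIntegrable _ _)]
  ring

/-- The energy inequality: `(y²)' = -2 l y² + 2 y F ≤ -l y² + F² / l`. -/
lemma duhamel_energy {l : ℝ} (hl : 0 < l) (a : ℝ) {F : ℝ → ℝ} (hF : Continuous F) {t : ℝ}
    (ht : 0 ≤ t) :
    duhamel l a F t ^ 2 + l * ∫ s in (0 : ℝ)..t, duhamel l a F s ^ 2 ≤
      a ^ 2 + l⁻¹ * ∫ s in (0 : ℝ)..t, F s ^ 2 := by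
  have hy := continuous_duhamel l a hF
  let G : ℝ → ℝ := fun t => l⁻¹ * (∫ s in (0 : ℝ)..t, F s ^ 2) -
    l * (∫ s in (0 : ℝ)..t, duhamel l a F s ^ 2) - duhamel l a F t ^ 2
  have hG : ∀ t, HasDerivAt G (l⁻¹ * F t ^ 2 - l * duhamel l a F t ^ 2 -
      2 * duhamel l a F t * (-(l * duhamel l a F t) + F t)) t := by
    intro t
    have h1 := ((hF.pow 2).integral_hasStrictDerivAt 0 t).hasDerivAt.const_mul l⁻¹
    have h2 := ((hy.pow 2).integral_hasStrictDerivAt 0 t).hasDerivAt.const_mul l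
    have h3 := (hasDerivAt_duhamel l a hF t).fun_pow 2
    refine ((h1.fun_sub h2).fun_sub h3).congr_deriv ?_
    norm_num
  have hmono : Monotone G := by
    refine monotone_of_deriv_nonneg (fun t => (hG t).differentiableAt) fun t => ?_
    rw [(hG t).deriv]
    have : l⁻¹ * F t ^ 2 - l * duhamel l a F t ^ 2 -
        2 * duhamel l a F t * (-(l * duhamel l a F t) + F t) =
        l⁻¹ * (F t - l * duhamel l a F t) ^ 2 := by
      field_simp
      ring
    rw [this]
    positivity
  have h := hmono ht
  simp only [G, intervalIntegral.integral_same, duhamel_zero] at h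
  linarith

/-- Gronwall's inequality in integral form. -/
lemma le_mul_exp_of_le_integral {u : ℝ → ℝ} (hu : Continuous u) {a b T : ℝ} (hb : 0 ≤ b)
    (h : ∀ t ∈ Icc 0 T, u t ≤ a + b * ∫ s in (0 : ℝ)..t, u s) :
    ∀ t ∈ Icc 0 T, u t ≤ a * Real.exp (b * t) := by
  let G : ℝ → ℝ := fun t => (a + b * ∫ s in (0 : ℝ)..t, u s) * Real.exp (-(b * t))
  have hG : ∀ t, HasDerivAt G ((b * u t) * Real.exp (-(b * t)) +
      (a + b * ∫ s in (0 : ℝ)..t, u s) * (Real.exp (-(b * t)) * -b)) t := by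
    intro t
    have h1 := ((hu.integral_hasStrictDerivAt 0 t).hasDerivAt.const_mul b).const_add a
    have h2 : HasDerivAt (fun t : ℝ => Real.exp (-(b * t))) (Real.exp (-(b * t)) * -b) t := by
      have := (((hasDerivAt_id t).const_mul b).fun_neg).exp
      simpa using this
    exact h1.mul h2
  have hanti : AntitoneOn G (Icc 0 T) := by
    refine antitoneOn_of_deriv_nonpos (convex_Icc 0 T)
      (fun t _ => (hG t).continuousAt.continuousWithinAt)
      (fun t _ => (hG t).differentiableAt.differentiableWithinAt) fun t ht => ?_
    rw [interior_Icc] at ht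
    rw [(hG t).deriv]
    have h1 := h t (Ioo_subset_Icc_self ht)
    have h2 := Real.exp_pos (-(b * t))
    nlinarith [mul_nonneg hb h2.le]
  intro t ht
  have h1 := hanti (left_mem_Icc.2 (ht.1.trans ht.2)) ht ht.1
  simp only [G, intervalIntegral.integral_same, mul_zero, add_zero, neg_zero, Real.exp_zero,
    mul_one] at h1
  have h2 : Real.exp (-(b * t)) * Real.exp (b * t) = 1 := by
    rw [← Real.exp_add, neg_add_cancel, Real.exp_zero]
  have h3 := mul_le_mul_of_nonneg_right h1 (Real.exp_pos (b * t)).le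
  rw [mul_assoc, h2, mul_one] at h3
  exact (h t ht).trans h3

/-! ### Weak derivatives in time -/

/-- The lemma of du Bois-Reymond: a continuous function with continuous weak derivative is
a primitive of it. -/
lemma eq_add_integral_of_weakDeriv {p q : ℝ → ℝ} (hp : Continuous p) (hq : Continuous q) {T : ℝ}
    (hT : 0 < T) (h : ∀ θ : ℝ → ℝ, ContDiff ℝ ∞ θ → tsupport θ ⊆ Ioo 0 T →
      ∫ t in (0 : ℝ)..T, deriv θ t * p t = -∫ t in (0 : ℝ)..T, θ t * q t) :
    ∀ t ∈ Icc 0 T, p t = p 0 + ∫ s in (0 : ℝ)..t, q s := by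
  let G : ℝ → ℝ := fun t => p t - ∫ s in (0 : ℝ)..t, q s
  have hint : ∀ t, HasDerivAt (fun t => ∫ s in (0 : ℝ)..t, q s) (q t) t := fun t =>
    (hq.integral_hasStrictDerivAt 0 t).hasDerivAt
  have hPc : Continuous fun t => ∫ s in (0 : ℝ)..t, q s :=
    continuous_iff_continuousAt.2 fun t => (hint t).continuousAt
  have hGc : Continuous G := hp.sub hPc
  -- `G` has weak derivative zero
  have hG : ∀ θ : ℝ → ℝ, ContDiff ℝ ∞ θ → tsupport θ ⊆ Ioo 0 T →
      ∫ t in (0 : ℝ)..T, deriv θ t * G t = 0 := by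
    intro θ hθ hs
    have hθc := hθ.continuous
    have h0 : θ 0 = 0 := image_eq_zero_of_notMem_tsupport fun h0 => (hs h0).1.false
    have h1 : θ T = 0 := image_eq_zero_of_notMem_tsupport fun h0 => (hs h0).2.false
    have hθ' : Continuous (deriv θ) := hθ.continuous_deriv (by simp)
    have h2 := intervalIntegral.integral_deriv_mul_eq_sub (a := 0) (b := T)
      (fun t _ => (hθ.differentiable (by simp) t).hasDerivAt) (fun t _ => hint t)
      (hθ'.intervalIntegrable _ _) (hq.intervalIntegrable _ _)
    rw [intervalIntegral.integral_add (Continuous.intervalIntegrable (by fun_prop) _ _)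
      (Continuous.intervalIntegrable (by fun_prop) _ _), h0, h1] at h2
    have h3 := h θ hθ hs
    simp only [G, mul_sub]
    rw [intervalIntegral.integral_sub (Continuous.intervalIntegrable (by fun_prop) _ _)
      (Continuous.intervalIntegrable (by fun_prop) _ _), h3]
    linarith
  -- a fixed bump of integral one
  obtain ⟨η, hηs, hηi, hη1⟩ : ∃ η : ℝ → ℝ, ContDiff ℝ ∞ η ∧ tsupport η ⊆ Ioo 0 T ∧
      ∫ t in (0 : ℝ)..T, η t = 1 := by
    let b : ContDiffBump (T / 2) := ⟨T / 8, T / 4, by linarith, by linarith⟩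
    have hs : tsupport (b.normed volume) ⊆ Ioo 0 T := by
      rw [b.tsupport_normed_eq, Real.closedBall_eq_Icc]
      intro x hx
      simp only [b, mem_Icc] at hx
      exact ⟨by linarith [hx.1], by linarith [hx.2]⟩
    refine ⟨b.normed volume, b.contDiff_normed, hs, ?_⟩
    rw [intervalIntegral.integral_of_le hT.le, setIntegral_eq_integral_of_forall_compl_eq_zero]
    · exact b.integral_normed
    · intro x hx
      exact image_eq_zero_of_notMem_tsupport fun h => hx (Ioo_subset_Ioc_self (hs h))
  have hηc := hηs.continuous
  set c := ∫ t in (0 : ℝ)..T, η t * G t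
  -- every test function of integral zero is the derivative of a test function
  have hχ : ∀ χ : ℝ → ℝ, ContDiff ℝ ∞ χ → tsupport χ ⊆ Ioo 0 T →
      ∫ t in (0 : ℝ)..T, χ t * (G t - c) = 0 := by
    intro χ hχ hs
    have hχc := hχ.continuous
    set m := ∫ t in (0 : ℝ)..T, χ t
    let ζ : ℝ → ℝ := fun t => χ t - m * η t
    have hζ : ContDiff ℝ ∞ ζ := hχ.sub (contDiff_const.mul hηs)
    let θ : ℝ → ℝ := fun t => ∫ s in (0 : ℝ)..t, ζ s
    have hθd : ∀ t, HasDerivAt θ (ζ t) t := fun t =>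
      (hζ.continuous.integral_hasStrictDerivAt 0 t).hasDerivAt
    have hθ' : deriv θ = ζ := funext fun t => (hθd t).deriv
    have hθ : ContDiff ℝ ∞ θ := by
      rw [contDiff_infty_iff_deriv]
      exact ⟨fun t => (hθd t).differentiableAt, by rwa [hθ']⟩
    have hK : IsClosed (tsupport χ ∪ tsupport η) := (isClosed_tsupport _).union (isClosed_tsupport _)
    have hKs : tsupport χ ∪ tsupport η ⊆ Ioo 0 T := union_subset hs hηi
    have hζ0 : ∀ t, t ∉ tsupport χ ∪ tsupport η → ζ t = 0 := by
      intro t ht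
      rw [mem_union, not_or] at ht
      simp only [ζ, image_eq_zero_of_notMem_tsupport ht.1, image_eq_zero_of_notMem_tsupport ht.2,
        mul_zero, sub_zero]
    have hcomp : IsCompact (tsupport χ ∪ tsupport η) :=
      (isCompact_Icc (a := (0 : ℝ)) (b := T)).of_isClosed_subset hK
        (hKs.trans Ioo_subset_Icc_self)
    have hθT : θ T = 0 := by
      simp only [θ, ζ]
      rw [intervalIntegral.integral_sub (Continuous.intervalIntegrable (by fun_prop) _ _)
        (Continuous.intervalIntegrable (by fun_prop) _ _),
        intervalIntegral.integral_const_mul, hη1, mul_one, sub_self]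
    have hsupp : tsupport θ ⊆ Ioo 0 T := by
      obtain ⟨a, b, ha, hb, hab⟩ : ∃ a b : ℝ, 0 < a ∧ b < T ∧
          tsupport χ ∪ tsupport η ⊆ Icc a b := by
        by_cases hne : (tsupport χ ∪ tsupport η).Nonempty
        · refine ⟨sInf (tsupport χ ∪ tsupport η), sSup (tsupport χ ∪ tsupport η),
            (hKs (hcomp.sInf_mem hne)).1, (hKs (hcomp.sSup_mem hne)).2, fun x hx =>
            ⟨csInf_le hcomp.bddBelow hx, le_csSup hcomp.bddAbove hx⟩⟩
        · rw [not_nonempty_iff_eq_empty] at hne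
          exact ⟨T, 0, hT, hT, by rw [hne]; exact empty_subset _⟩
      have h1 : Function.support θ ⊆ Icc a b := by
        intro t ht
        by_contra hn
        apply ht
        rcases lt_or_ge t a with h1 | h1
        · refine intervalIntegral.integral_zero_ae (Filter.Eventually.of_forall fun s hs => ?_)
          refine hζ0 s fun hs' => ?_
          have := (hab hs').1
          rcases mem_uIoc.1 hs with h2 | h2 <;> linarith [h2.1, h2.2]
        · have h2 : b < t := by
            by_contra h3
            exact hn ⟨h1, not_lt.1 h3⟩
          have h3 : θ t = θ T + ∫ s in T..t, ζ s :=
            (intervalIntegral.integral_add_adjacent_intervals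
              (hζ.continuous.intervalIntegrable _ _) (hζ.continuous.intervalIntegrable _ _)).symm
          rw [h3, hθT, zero_add]
          refine intervalIntegral.integral_zero_ae (Filter.Eventually.of_forall fun s hs => ?_)
          refine hζ0 s fun hs' => ?_
          have := (hab hs').2
          rcases mem_uIoc.1 hs with h4 | h4 <;> linarith [h4.1, h4.2]
      exact (closure_minimal h1 isClosed_Icc).trans fun x hx =>
        ⟨ha.trans_le hx.1, hx.2.trans_lt hb⟩
    have h1 := hG θ hθ hsupp
    rw [hθ'] at h1
    simp only [ζ, sub_mul, mul_assoc] at h1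
    rw [intervalIntegral.integral_sub (Continuous.intervalIntegrable (by fun_prop) _ _)
      (Continuous.intervalIntegrable (by fun_prop) _ _),
      intervalIntegral.integral_const_mul] at h1
    simp only [mul_sub]
    rw [intervalIntegral.integral_sub (Continuous.intervalIntegrable (by fun_prop) _ _)
      (Continuous.intervalIntegrable (by fun_prop) _ _),
      intervalIntegral.integral_mul_const]
    exact h1
  have hae : ∀ᵐ t : ℝ, t ∈ Ioo 0 T → G t - c = 0 := by
    refine isOpen_Ioo.ae_eq_zero_of_integral_contDiff_smul_eq_zero
      ((hGc.sub continuous_const).continuousOn.locallyIntegrableOn measurableSet_Ioo)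
      fun χ hc _ hs => ?_
    rw [← hχ χ hc hs, intervalIntegral.integral_of_le hT.le,
      setIntegral_eq_integral_of_forall_compl_eq_zero]
    · rfl
    · intro x hx
      rw [image_eq_zero_of_notMem_tsupport fun h => hx (Ioo_subset_Ioc_self (hs h)), zero_mul]
  have heq : EqOn G (fun _ => c) (Icc 0 T) := by
    have h1 : EqOn G (fun _ => c) (Ioo 0 T) := by
      refine Measure.eqOn_open_of_ae_eq (μ := volume) ?_ isOpen_Ioo hGc.continuousOn
        continuousOn_const
      rw [Filter.EventuallyEq, ae_restrict_iff' measurableSet_Ioo]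
      filter_upwards [hae] with t ht h
      exact sub_eq_zero.1 (ht h)
    rw [← closure_Ioo hT.ne]
    exact h1.closure hGc continuous_const
  intro t ht
  have h1 := heq ht
  have h2 := heq (left_mem_Icc.2 hT.le)
  simp only [G, intervalIntegral.integral_same, sub_zero] at h1 h2
  rw [h2]
  linarith

/-- A continuous weak solution of `y' = -l y + F` is given by Duhamel's formula. -/
lemma eq_duhamel_of_weakDeriv {p F : ℝ → ℝ} (hp : Continuous p) (hF : Continuous F) {T : ℝ}
    (hT : 0 < T) (l : ℝ) (h : ∀ θ : ℝ → ℝ, ContDiff ℝ ∞ θ → tsupport θ ⊆ Ioo 0 T →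
      ∫ t in (0 : ℝ)..T, deriv θ t * p t = -∫ t in (0 : ℝ)..T, θ t * (-(l * p t) + F t)) :
    ∀ t ∈ Icc 0 T, p t = duhamel l (p 0) F t := by
  have hc : Continuous fun t : ℝ => Real.exp (l * t) := by fun_prop
  have key := eq_add_integral_of_weakDeriv (p := fun t => Real.exp (l * t) * p t)
    (q := fun t => Real.exp (l * t) * F t) (by fun_prop) (by fun_prop) hT fun θ hθ hs => by
    have hθe : ContDiff ℝ ∞ fun t => θ t * Real.exp (l * t) :=
      hθ.mul (Real.contDiff_exp.comp (contDiff_const.mul contDiff_id))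
    have hs' : tsupport (fun t => θ t * Real.exp (l * t)) ⊆ Ioo 0 T :=
      (tsupport_mul_subset_left (f := θ) (g := fun t => Real.exp (l * t))).trans hs
    have h1 := h _ hθe hs'
    have hd : ∀ t, deriv (fun t => θ t * Real.exp (l * t)) t =
        deriv θ t * Real.exp (l * t) + θ t * (Real.exp (l * t) * l) := by
      intro t
      have h2 : HasDerivAt (fun t : ℝ => Real.exp (l * t)) (Real.exp (l * t) * l) t := by
        simpa using ((hasDerivAt_id t).const_mul l).exp
      exact ((hθ.differentiable (by simp) t).hasDerivAt.mul h2).deriv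
    have hθ' : Continuous (deriv θ) := hθ.continuous_deriv (by simp)
    have hθc := hθ.continuous
    simp only [hd] at h1
    have e1 : ∀ t, (deriv θ t * Real.exp (l * t) + θ t * (Real.exp (l * t) * l)) * p t =
        deriv θ t * (Real.exp (l * t) * p t) + θ t * Real.exp (l * t) * (l * p t) := fun t => by
      ring
    have e2 : ∀ t, θ t * Real.exp (l * t) * (-(l * p t) + F t) =
        θ t * (Real.exp (l * t) * F t) - θ t * Real.exp (l * t) * (l * p t) := fun t => by ring
    simp only [e1, e2] at h1
    rw [intervalIntegral.integral_add (Continuous.intervalIntegrable (by fun_prop) _ _)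
        (Continuous.intervalIntegrable (by fun_prop) _ _),
      intervalIntegral.integral_sub (Continuous.intervalIntegrable (by fun_prop) _ _)
        (Continuous.intervalIntegrable (by fun_prop) _ _)] at h1
    linarith
  intro t ht
  have h1 := key t ht
  simp only [mul_zero, Real.exp_zero, one_mul] at h1
  rw [duhamel, ← h1, ← mul_assoc, ← Real.exp_add, neg_add_cancel, Real.exp_zero, one_mul]

/-- Duhamel's formula gives a weak solution. -/
lemma weakDeriv_duhamel (l a : ℝ) {F : ℝ → ℝ} (hF : Continuous F) {T : ℝ} {θ : ℝ → ℝ}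
    (hθ : ContDiff ℝ ∞ θ) (hs : tsupport θ ⊆ Ioo 0 T) :
    ∫ t in (0 : ℝ)..T, deriv θ t * duhamel l a F t =
      -∫ t in (0 : ℝ)..T, θ t * (-(l * duhamel l a F t) + F t) := by
  have h0 : θ 0 = 0 := image_eq_zero_of_notMem_tsupport fun h0 => (hs h0).1.false
  have h1 : θ T = 0 := image_eq_zero_of_notMem_tsupport fun h0 => (hs h0).2.false
  have hθ' : Continuous (deriv θ) := hθ.continuous_deriv (by simp)
  have hθc := hθ.continuous
  have hy := continuous_duhamel l a hF
  have h2 := intervalIntegral.integral_deriv_mul_eq_sub (a := 0) (b := T)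
    (fun t _ => (hθ.differentiable (by simp) t).hasDerivAt)
    (fun t _ => hasDerivAt_duhamel l a hF t)
    (hθ'.intervalIntegrable _ _) (Continuous.intervalIntegrable (by fun_prop) _ _)
  rw [intervalIntegral.integral_add (Continuous.intervalIntegrable (by fun_prop) _ _)
    (Continuous.intervalIntegrable (by fun_prop) _ _), h0, h1] at h2
  linarith

/-! ### Weighted coefficient systems -/

/-- A description of a Hilbert space `E` as a weighted `ℓ²` space: coordinates `coef`, for which
`‖u‖² = ∑ₙ wₙ (coefₙ u)²`, and vectors `vec` with `u = ∑ₙ (coefₙ u) vecₙ`; every sequence of finite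
weighted norm occurs. -/
structure CoefSystem (ι E : Type*) [NormedAddCommGroup E] [NormedSpace ℝ E] where
  weight : ι → ℝ
  coef : ι → E →L[ℝ] ℝ
  vec : ι → E
  weight_pos : ∀ n, 0 < weight n
  hasSum_sq : ∀ u, HasSum (fun n => weight n * coef n u ^ 2) (‖u‖ ^ 2)
  hasSum_vec : ∀ u, HasSum (fun n => coef n u • vec n) u
  exists_coef : ∀ a : ι → ℝ, (Summable fun n => weight n * a n ^ 2) → ∃ u, ∀ n, coef n u = a n

namespace CoefSystem

variable {ι E : Type*} [NormedAddCommGroup E] [NormedSpace ℝ E] (S : CoefSystem ι E)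

lemma ext_coef {u v : E} (h : ∀ n, S.coef n u = S.coef n v) : u = v :=
  (S.hasSum_vec u).unique (by simpa only [h] using S.hasSum_vec v)

lemma norm_sq_le {u : E} {M : ι → ℝ} {B : ℝ} (hM : HasSum M B)
    (h : ∀ n, S.weight n * S.coef n u ^ 2 ≤ M n) : ‖u‖ ^ 2 ≤ B :=
  hasSum_le h (S.hasSum_sq u) hM

/-- A function with continuous coordinates is continuous if it is dominated. -/
lemma continuous_of_dominated {α : Type*} [TopologicalSpace α] {u : α → E} {M : ι → ℝ}
    (hM : Summable M) (hu : ∀ n, Continuous fun t => S.coef n (u t))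
    (h : ∀ t n, S.weight n * S.coef n (u t) ^ 2 ≤ M n) : Continuous u := by
  rw [continuous_iff_continuousAt]
  intro s
  have h1 : Filter.Tendsto (fun t => ∑' n, S.weight n * S.coef n (u t - u s) ^ 2) (nhds s)
      (nhds (∑' _ : ι, (0 : ℝ))) := by
    refine tendsto_tsum_of_dominated_convergence (hM.mul_left 4) (fun n => ?_)
      (Filter.Eventually.of_forall fun t n => ?_)
    · have hc : Continuous fun t => S.weight n * S.coef n (u t - u s) ^ 2 := by
        simp only [map_sub]
        have := hu n
        fun_prop
      have := hc.tendsto s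
      simpa using this
    · have h2 := S.weight_pos n
      rw [Real.norm_of_nonneg (by positivity), map_sub]
      nlinarith [h t n, h s n, mul_nonneg h2.le (sq_nonneg (S.coef n (u t) + S.coef n (u s)))]
  rw [tsum_zero] at h1
  simp only [(S.hasSum_sq _).tsum_eq] at h1
  rw [ContinuousAt, tendsto_iff_norm_sub_tendsto_zero]
  have h2 := h1.sqrt
  simpa only [Real.sqrt_sq (norm_nonneg _), Real.sqrt_zero] using h2

lemma hasSum_integral {φ : ℝ → E} (hφ : Continuous φ) (t : ℝ) [Countable ι] :
    HasSum (fun n => ∫ s in (0 : ℝ)..t, S.weight n * S.coef n (φ s) ^ 2)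
      (∫ s in (0 : ℝ)..t, ‖φ s‖ ^ 2) := by
  refine intervalIntegral.hasSum_integral_of_dominated_convergence
    (fun n s => S.weight n * S.coef n (φ s) ^ 2)
    (fun n => Continuous.aestronglyMeasurable (by fun_prop))
    (fun n => Filter.Eventually.of_forall fun s _ => ?_)
    (Filter.Eventually.of_forall fun s _ => (S.hasSum_sq _).summable) ?_
    (Filter.Eventually.of_forall fun s _ => S.hasSum_sq _)
  · have := S.weight_pos n
    rw [Real.norm_of_nonneg (by positivity)]
  · simp only [(S.hasSum_sq _).tsum_eq]
    exact Continuous.intervalIntegrable (by fun_prop) _ _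

lemma enorm_sq_eq_tsum (u : E) :
    ‖u‖ₑ ^ 2 = ∑' n, ENNReal.ofReal (S.weight n * S.coef n u ^ 2) := by
  rw [← ENNReal.ofReal_tsum_of_nonneg (fun n => ?_) (S.hasSum_sq u).summable,
    (S.hasSum_sq u).tsum_eq, ← ofReal_norm, ENNReal.ofReal_pow (norm_nonneg _)]
  have := S.weight_pos n
  positivity

variable {Ω : Type*} [MeasurableSpace Ω] {μ : Measure Ω} [Countable ι]

lemma lintegral_tsum_eq {y : ι → Ω → ℝ} (hy2 : ∀ n, Integrable (fun t => y n t ^ 2) μ)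
    (hs : Summable fun n => S.weight n * ∫ t, y n t ^ 2 ∂μ) :
    ∫⁻ t, ∑' n, ENNReal.ofReal (S.weight n * y n t ^ 2) ∂μ =
      ENNReal.ofReal (∑' n, S.weight n * ∫ t, y n t ^ 2 ∂μ) := by
  rw [lintegral_tsum fun n => ((hy2 n).aemeasurable.const_mul _).ennreal_ofReal,
    ENNReal.ofReal_tsum_of_nonneg (fun n => mul_nonneg (S.weight_pos n).le
      (integral_nonneg fun t => sq_nonneg _)) hs]
  refine tsum_congr fun n => ?_
  rw [← integral_const_mul, ofReal_integral_eq_lintegral_ofReal ((hy2 n).const_mul _)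
    (Filter.Eventually.of_forall fun t => mul_nonneg (S.weight_pos n).le (sq_nonneg _))]

/-- A Bochner square integrable function with prescribed coordinates. It is strongly measurable
as an a.e. limit of the partial sums of its expansion. -/
lemma exists_Lp_coef_eq {y : ι → Ω → ℝ} (hy : ∀ n, AEStronglyMeasurable (y n) μ)
    (hy2 : ∀ n, Integrable (fun t => y n t ^ 2) μ)
    (hs : Summable fun n => S.weight n * ∫ t, y n t ^ 2 ∂μ) :
    ∃ g : Lp E 2 μ, ∀ᵐ t ∂μ, ∀ n, S.coef n (g t) = y n t := by
  classical
  have h1 := S.lintegral_tsum_eq hy2 hs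
  have hm : AEMeasurable (fun t => ∑' n, ENNReal.ofReal (S.weight n * y n t ^ 2)) μ :=
    AEMeasurable.tsum fun n => ((hy2 n).aemeasurable.const_mul _).ennreal_ofReal
  have h2 : ∀ᵐ t ∂μ, Summable fun n => S.weight n * y n t ^ 2 := by
    filter_upwards [ae_lt_top' hm (by rw [h1]; exact ENNReal.ofReal_ne_top)] with t ht
    exact (ENNReal.summable_toReal ht.ne).congr fun n =>
      ENNReal.toReal_ofReal (mul_nonneg (S.weight_pos n).le (sq_nonneg _))
  let G : Ω → E := fun t =>
    if h : Summable fun n => S.weight n * y n t ^ 2 then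
      (S.exists_coef (fun n => y n t) h).choose else 0
  have hG : ∀ᵐ t ∂μ, ∀ n, S.coef n (G t) = y n t := by
    filter_upwards [h2] with t ht n
    simp only [G, dif_pos ht]
    exact (S.exists_coef (fun n => y n t) ht).choose_spec n
  have hGm : AEStronglyMeasurable G μ := by
    refine aestronglyMeasurable_of_tendsto_ae (Filter.atTop : Filter (Finset ι))
      (f := fun s t => ∑ n ∈ s, y n t • S.vec n)
      (fun s => Finset.aestronglyMeasurable_fun_sum s fun n _ => (hy n).smul_const _) ?_
    filter_upwards [hG] with t ht
    have := S.hasSum_vec (G t)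
    simp only [ht] at this
    exact this
  have hGi : MemLp G 2 μ := by
    refine ⟨hGm, ?_⟩
    rw [eLpNorm_lt_top_iff_lintegral_rpow_enorm_lt_top (by simp) (by simp)]
    have : ∫⁻ t, ‖G t‖ₑ ^ (2 : ENNReal).toReal ∂μ =
        ∫⁻ t, ∑' n, ENNReal.ofReal (S.weight n * y n t ^ 2) ∂μ := by
      refine lintegral_congr_ae ?_
      filter_upwards [hG] with t ht
      simp only [ENNReal.toReal_ofNat, ENNReal.rpow_ofNat]
      rw [S.enorm_sq_eq_tsum]
      simp only [ht]
    rw [this, h1]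
    exact ENNReal.ofReal_lt_top
  refine ⟨hGi.toLp, ?_⟩
  filter_upwards [hG, hGi.coeFn_toLp] with t h1 h2 n
  rw [h2, h1]

lemma norm_Lp_sq_le {y : ι → Ω → ℝ} (hy2 : ∀ n, Integrable (fun t => y n t ^ 2) μ)
    (hs : Summable fun n => S.weight n * ∫ t, y n t ^ 2 ∂μ) {g : Lp E 2 μ}
    (hg : ∀ᵐ t ∂μ, ∀ n, S.coef n (g t) = y n t) :
    ‖g‖ ^ 2 ≤ ∑' n, S.weight n * ∫ t, y n t ^ 2 ∂μ := by
  have h0 : 0 ≤ ∑' n, S.weight n * ∫ t, y n t ^ 2 ∂μ :=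
    tsum_nonneg fun n => mul_nonneg (S.weight_pos n).le (integral_nonneg fun t => sq_nonneg _)
  have h1 : eLpNorm g 2 μ ^ 2 = ENNReal.ofReal (∑' n, S.weight n * ∫ t, y n t ^ 2 ∂μ) := by
    rw [← S.lintegral_tsum_eq hy2 hs]
    have h2 := eLpNorm_nnreal_pow_eq_lintegral (f := g) (μ := μ) (p := 2) (by norm_num)
    simp only [ENNReal.coe_ofNat, NNReal.coe_ofNat, ENNReal.rpow_ofNat] at h2
    rw [h2]
    refine lintegral_congr_ae ?_
    filter_upwards [hg] with t ht
    rw [S.enorm_sq_eq_tsum]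
    simp only [ht]
  rw [Lp.norm_def, ← ENNReal.toReal_pow, h1, ENNReal.toReal_ofReal h0]

end CoefSystem

/-! ### The heat equation in weighted coefficient systems -/

section Heat

variable {ι E₁ E₂ : Type*} [NormedAddCommGroup E₁] [NormedSpace ℝ E₁]
  [NormedAddCommGroup E₂] [NormedSpace ℝ E₂] (S₁ : CoefSystem ι E₁) (S₂ : CoefSystem ι E₂)
  {l : ι → ℝ} {C : ℝ}

/-- The coordinates of the mild solution of `u' = -l u + F`, `u(0) = f`. -/
noncomputable def mild (l : ι → ℝ) (f : E₂) (F : ℝ → E₁) (n : ι) (t : ℝ) : ℝ :=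
  duhamel (l n) (S₂.coef n f) (fun s => S₁.coef n (F s)) t

lemma continuous_mild (f : E₂) {F : ℝ → E₁} (hF : Continuous F) (n : ι) :
    Continuous (mild S₁ S₂ l f F n) :=
  continuous_duhamel _ _ (by fun_prop)

/-- The energy estimate, coordinate by coordinate. -/
lemma mild_energy (hl : ∀ n, 0 < l n) (hC : ∀ n, S₂.weight n ≤ C * l n * S₁.weight n)
    (f : E₂) {F : ℝ → E₁} (hF : Continuous F) (n : ι) {t : ℝ} (ht : 0 ≤ t) :
    S₂.weight n * mild S₁ S₂ l f F n t ^ 2 +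
        S₂.weight n * l n * ∫ s in (0 : ℝ)..t, mild S₁ S₂ l f F n s ^ 2 ≤
      S₂.weight n * S₂.coef n f ^ 2 +
        C * ∫ s in (0 : ℝ)..t, S₁.weight n * S₁.coef n (F s) ^ 2 := by
  have h1 := duhamel_energy (hl n) (S₂.coef n f)
    (F := fun s => S₁.coef n (F s)) (by fun_prop) ht
  have h2 := mul_le_mul_of_nonneg_left h1 (S₂.weight_pos n).le
  have h3 : 0 ≤ ∫ s in (0 : ℝ)..t, S₁.coef n (F s) ^ 2 :=
    intervalIntegral.integral_nonneg ht fun s _ => sq_nonneg _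
  have h4 : S₂.weight n * (l n)⁻¹ ≤ C * S₁.weight n := by
    rw [mul_inv_le_iff₀ (hl n)]
    linarith [hC n]
  have h5 := mul_le_mul_of_nonneg_right h4 h3
  rw [intervalIntegral.integral_const_mul]
  unfold mild
  linarith

variable [Countable ι]

lemma hasSum_mild_data (f : E₂) {F : ℝ → E₁} (hF : Continuous F) (t : ℝ) :
    HasSum (fun n => S₂.weight n * S₂.coef n f ^ 2 +
        C * ∫ s in (0 : ℝ)..t, S₁.weight n * S₁.coef n (F s) ^ 2)
      (‖f‖ ^ 2 + C * ∫ s in (0 : ℝ)..t, ‖F s‖ ^ 2) :=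
  (S₂.hasSum_sq f).add ((S₁.hasSum_integral hF t).mul_left C)

lemma mild_norm_sq_le (hl : ∀ n, 0 < l n) (hC : ∀ n, S₂.weight n ≤ C * l n * S₁.weight n)
    (f : E₂) {F : ℝ → E₁} (hF : Continuous F) {t : ℝ} (ht : 0 ≤ t) {u : E₂}
    (hu : ∀ n, S₂.coef n u = mild S₁ S₂ l f F n t) :
    ‖u‖ ^ 2 ≤ ‖f‖ ^ 2 + C * ∫ s in (0 : ℝ)..t, ‖F s‖ ^ 2 := by
  refine S₂.norm_sq_le (hasSum_mild_data S₁ S₂ f hF t) fun n => ?_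
  have h1 := mild_energy S₁ S₂ hl hC f hF n ht
  have h2 : 0 ≤ S₂.weight n * l n * ∫ s in (0 : ℝ)..t, mild S₁ S₂ l f F n s ^ 2 :=
    mul_nonneg (mul_pos (S₂.weight_pos n) (hl n)).le
      (intervalIntegral.integral_nonneg ht fun s _ => sq_nonneg _)
  rw [hu]
  linarith

/-- The gain of one derivative in `L²` in time. -/
lemma mild_dissipation (hl : ∀ n, 0 < l n) (hC : ∀ n, S₂.weight n ≤ C * l n * S₁.weight n)
    (f : E₂) {F : ℝ → E₁} (hF : Continuous F) {t : ℝ} (ht : 0 ≤ t) :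
    (Summable fun n => S₂.weight n * l n * ∫ s in (0 : ℝ)..t, mild S₁ S₂ l f F n s ^ 2) ∧
    ∑' n, S₂.weight n * l n * ∫ s in (0 : ℝ)..t, mild S₁ S₂ l f F n s ^ 2 ≤
      ‖f‖ ^ 2 + C * ∫ s in (0 : ℝ)..t, ‖F s‖ ^ 2 := by
  have h0 := hasSum_mild_data S₁ S₂ (C := C) f hF t
  have h1 : ∀ n, S₂.weight n * l n * ∫ s in (0 : ℝ)..t, mild S₁ S₂ l f F n s ^ 2 ≤
      S₂.weight n * S₂.coef n f ^ 2 +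
        C * ∫ s in (0 : ℝ)..t, S₁.weight n * S₁.coef n (F s) ^ 2 := by
    intro n
    have h1 := mild_energy S₁ S₂ hl hC f hF n ht
    have h2 := mul_nonneg (S₂.weight_pos n).le (sq_nonneg (mild S₁ S₂ l f F n t))
    linarith
  have h2 : ∀ n, 0 ≤ S₂.weight n * l n * ∫ s in (0 : ℝ)..t, mild S₁ S₂ l f F n s ^ 2 := fun n =>
    mul_nonneg (mul_pos (S₂.weight_pos n) (hl n)).le
      (intervalIntegral.integral_nonneg ht fun s _ => sq_nonneg _)
  have h3 := Summable.of_nonneg_of_le h2 h1 h0.summable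
  refine ⟨h3, ?_⟩
  rw [← h0.tsum_eq]
  exact h3.tsum_le_tsum h1 h0.summable

/-- The mild solution is a continuous function of time: its coordinates at all times are dominated
by those of the data. -/
lemma exists_mild (hl : ∀ n, 0 < l n) (hC0 : 0 ≤ C)
    (hC : ∀ n, S₂.weight n ≤ C * l n * S₁.weight n)
    (f : E₂) {F : ℝ → E₁} (hF : Continuous F) (T : ℝ) :
    ∃ φ : C(J T, E₂), ∀ t n, S₂.coef n (φ t) = mild S₁ S₂ l f F n t := by
  have hb : ∀ (t : J T) n, S₂.weight n * mild S₁ S₂ l f F n t ^ 2 ≤ S₂.weight n * S₂.coef n f ^ 2 +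
      C * ∫ s in (0 : ℝ)..T, S₁.weight n * S₁.coef n (F s) ^ 2 := by
    intro t n
    have h1 := mild_energy S₁ S₂ hl hC f hF n t.2.1
    have h2 : 0 ≤ S₂.weight n * l n * ∫ s in (0 : ℝ)..t, mild S₁ S₂ l f F n s ^ 2 :=
      mul_nonneg (mul_pos (S₂.weight_pos n) (hl n)).le
        (intervalIntegral.integral_nonneg t.2.1 fun s _ => sq_nonneg _)
    have h3 : ∫ s in (0 : ℝ)..t, S₁.weight n * S₁.coef n (F s) ^ 2 ≤
        ∫ s in (0 : ℝ)..T, S₁.weight n * S₁.coef n (F s) ^ 2 := by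
      refine intervalIntegral.integral_mono_interval le_rfl t.2.1 t.2.2
        (Filter.Eventually.of_forall fun s => mul_nonneg (S₁.weight_pos n).le (sq_nonneg _)) ?_
      exact Continuous.intervalIntegrable (by fun_prop) _ _
    have h4 := mul_le_mul_of_nonneg_left h3 hC0
    linarith
  have hs := (hasSum_mild_data S₁ S₂ (C := C) f hF T).summable
  have hex : ∀ t : J T, ∃ u, ∀ n, S₂.coef n u = mild S₁ S₂ l f F n t := fun t =>
    S₂.exists_coef _ (Summable.of_nonneg_of_le
      (fun n => mul_nonneg (S₂.weight_pos n).le (sq_nonneg _)) (hb t) hs)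
  choose u hu using hex
  refine ⟨⟨u, S₂.continuous_of_dominated hs (fun n => ?_) fun t n => ?_⟩, hu⟩
  · simp only [hu]
    exact (continuous_mild S₁ S₂ f hF n).comp continuous_subtype_val
  · rw [hu]
    exact hb t n

end Heat

/-! ### A fixed point theorem of Volterra type -/

/-- A function on `[0, T]`, extended to the line by constants. -/
noncomputable def extendTime {E : Type*} {T : ℝ} (hT : 0 ≤ T) (φ : J T → E) (s : ℝ) : E :=
  φ (projIcc 0 T hT s)

lemma extendTime_coe {E : Type*} {T : ℝ} (hT : 0 ≤ T) (φ : J T → E) (t : J T) :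
    extendTime hT φ t = φ t := by
  rw [extendTime, projIcc_val]

lemma continuous_extendTime {E : Type*} [TopologicalSpace E] {T : ℝ} (hT : 0 ≤ T) {φ : J T → E}
    (hφ : Continuous φ) : Continuous (extendTime hT φ) :=
  hφ.comp continuous_projIcc

/-- A map satisfying a Volterra type Lipschitz estimate has a unique fixed point: its `n`-th iterate
is Lipschitz with squared constant `(L T)^n / n!`, hence a contraction for large `n`. -/
lemma existsUnique_fixedPoint {E : Type*} [NormedAddCommGroup E] [CompleteSpace E] {T : ℝ}
    (hT : 0 ≤ T) {Φ : C(J T, E) → C(J T, E)} {L : ℝ} (hL : 0 ≤ L)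
    (h : ∀ φ ψ (t : J T), ‖Φ φ t - Φ ψ t‖ ^ 2 ≤
      L * ∫ s in (0 : ℝ)..t, ‖extendTime hT φ s - extendTime hT ψ s‖ ^ 2) :
    ∃! φ, Φ φ = φ := by
  have h1 : ∀ (n : ℕ) φ ψ (t : J T), ‖Φ^[n] φ t - Φ^[n] ψ t‖ ^ 2 ≤
      (L * t) ^ n / n.factorial * dist φ ψ ^ 2 := by
    intro n
    induction n with
    | zero =>
      intro φ ψ t
      have := ContinuousMap.dist_apply_le_dist (f := φ) (g := ψ) t
      rw [dist_eq_norm] at this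
      simpa using pow_le_pow_left₀ (norm_nonneg _) this 2
    | succ n ih =>
      intro φ ψ t
      rw [Function.iterate_succ_apply', Function.iterate_succ_apply']
      refine (h _ _ t).trans ?_
      have h2 : ∫ s in (0 : ℝ)..t, ‖extendTime hT (Φ^[n] φ) s - extendTime hT (Φ^[n] ψ) s‖ ^ 2 ≤
          ∫ s in (0 : ℝ)..t, (L ^ n / n.factorial * dist φ ψ ^ 2) * s ^ n := by
        have hc : ∀ φ : C(J T, E), Continuous (extendTime hT φ) := fun φ =>
          continuous_extendTime hT φ.continuous
        have hc1 := hc (Φ^[n] φ)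
        have hc2 := hc (Φ^[n] ψ)
        refine intervalIntegral.integral_mono_on t.2.1
          (Continuous.intervalIntegrable (by fun_prop) _ _)
          (Continuous.intervalIntegrable (by fun_prop) _ _) fun s hs => ?_
        have h3 := ih φ ψ ⟨s, hs.1, hs.2.trans t.2.2⟩
        rw [← extendTime_coe hT (Φ^[n] φ), ← extendTime_coe hT (Φ^[n] ψ)] at h3
        refine h3.trans (le_of_eq ?_)
        simp only [mul_pow]
        ring
      refine (mul_le_mul_of_nonneg_left h2 hL).trans (le_of_eq ?_)
      rw [intervalIntegral.integral_const_mul, integral_pow, Nat.factorial_succ]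
      push_cast
      field_simp
      ring
  obtain ⟨n, hn⟩ : ∃ n : ℕ, (L * T) ^ n / n.factorial < 1 / 4 :=
    ((FloorSemiring.tendsto_pow_div_factorial_atTop (L * T)).eventually
      (gt_mem_nhds (by norm_num))).exists
  have hc : ContractingWith (1 / 2) Φ^[n] := by
    refine ⟨by norm_num, LipschitzWith.of_dist_le_mul fun φ ψ => ?_⟩
    rw [ContinuousMap.dist_le (by positivity)]
    intro t
    rw [dist_eq_norm]
    refine abs_le_of_sq_le_sq' ?_ (by positivity) |>.2
    refine (h1 n φ ψ t).trans ?_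
    have h2 : (L * t) ^ n / n.factorial ≤ 1 / 4 := by
      refine le_trans ?_ hn.le
      have h3 := t.2.1
      have h4 := t.2.2
      gcongr
    refine (mul_le_mul_of_nonneg_right h2 (sq_nonneg _)).trans (le_of_eq ?_)
    push_cast
    ring
  refine ⟨_, hc.isFixedPt_fixedPoint_iterate, fun ψ hψ => ?_⟩
  exact hc.fixedPoint_unique (Function.IsFixedPt.iterate hψ n)

/-! ### The mild formulation with a bounded bilinear first order term -/

section Mild

variable {ι V E₁ E₂ : Type*} [Countable ι] [NormedAddCommGroup V] [NormedSpace ℝ V]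
  [NormedAddCommGroup E₁] [NormedSpace ℝ E₁] [NormedAddCommGroup E₂] [NormedSpace ℝ E₂]
  (S₁ : CoefSystem ι E₁) (S₂ : CoefSystem ι E₂) {l : ι → ℝ} {C T : ℝ} (hT : 0 ≤ T)
  (N : V →L[ℝ] E₂ →L[ℝ] E₁)

/-- The right-hand side `-N(v, φ)`, extended from `[0, T]` to the line by constants. -/
noncomputable def forcing (v : C(J T, V)) (φ : C(J T, E₂)) (s : ℝ) : E₁ :=
  -N (extendTime hT v s) (extendTime hT φ s)

lemma continuous_forcing (v : C(J T, V)) (φ : C(J T, E₂)) : Continuous (forcing hT N v φ) := by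
  have h1 := continuous_extendTime hT v.continuous
  have h2 := continuous_extendTime hT φ.continuous
  unfold forcing
  fun_prop

lemma norm_forcing_le (v : C(J T, V)) (φ : C(J T, E₂)) (s : ℝ) :
    ‖forcing hT N v φ s‖ ≤ ‖N‖ * ‖v‖ * ‖extendTime hT φ s‖ := by
  rw [forcing, norm_neg]
  refine (N.le_opNorm₂ _ _).trans ?_
  gcongr
  exact v.norm_coe_le_norm _

/-- `φ` is a mild solution of `φ' = -l φ - N(v, φ)`, `φ(0) = f`. -/
def IsMild (l : ι → ℝ) (v : C(J T, V)) (f : E₂) (φ : C(J T, E₂)) : Prop :=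
  ∀ t n, S₂.coef n (φ t) = mild S₁ S₂ l f (forcing hT N v φ) n t

/-- The Duhamel map satisfies a Volterra type estimate, since the gain of the heat semigroup makes
up for the loss of `N`. -/
lemma existsUnique_isMild [CompleteSpace E₂] (hl : ∀ n, 0 < l n) (hC0 : 0 ≤ C)
    (hC : ∀ n, S₂.weight n ≤ C * l n * S₁.weight n) (v : C(J T, V)) (f : E₂) :
    ∃! φ, IsMild S₁ S₂ hT N l v f φ := by
  choose Φ hΦ using fun φ : C(J T, E₂) =>
    exists_mild S₁ S₂ hl hC0 hC f (continuous_forcing hT N v φ) T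
  have hiff : ∀ φ, IsMild S₁ S₂ hT N l v f φ ↔ Φ φ = φ := by
    intro φ
    constructor
    · intro h
      ext t
      exact S₂.ext_coef fun n => by rw [hΦ, h]
    · intro h t n
      rw [← hΦ, h]
  simp only [hiff]
  refine existsUnique_fixedPoint hT (L := C * (‖N‖ * ‖v‖) ^ 2) (by positivity) fun φ ψ t => ?_
  have hcφ := continuous_forcing hT N v φ
  have hcψ := continuous_forcing hT N v ψ
  have h1 : ∀ n, S₂.coef n (Φ φ t - Φ ψ t) =
      mild S₁ S₂ l 0 (fun s => forcing hT N v φ s - forcing hT N v ψ s) n t := by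
    intro n
    rw [map_sub, hΦ, hΦ, mild, mild, duhamel_sub _ _ _ (by fun_prop) (by fun_prop), mild]
    simp only [sub_self, map_zero, map_sub]
  refine (mild_norm_sq_le S₁ S₂ hl hC 0 (F := fun s => forcing hT N v φ s - forcing hT N v ψ s)
    (hcφ.sub hcψ) t.2.1 h1).trans ?_
  have h2 := continuous_extendTime hT φ.continuous
  have h3 := continuous_extendTime hT ψ.continuous
  rw [norm_zero, zero_pow two_ne_zero, zero_add, mul_assoc]
  refine mul_le_mul_of_nonneg_left ?_ hC0
  rw [← intervalIntegral.integral_const_mul]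
  refine intervalIntegral.integral_mono_on t.2.1
    (Continuous.intervalIntegrable (by fun_prop) _ _)
    (Continuous.intervalIntegrable (by fun_prop) _ _) fun s _ => ?_
  rw [← mul_pow]
  refine pow_le_pow_left₀ (norm_nonneg _) ?_ 2
  have h4 : forcing hT N v φ s - forcing hT N v ψ s = forcing hT N v (φ - ψ) s := by
    simp only [forcing, extendTime, ContinuousMap.sub_apply, map_sub]
    abel
  rw [h4]
  exact norm_forcing_le hT N v (φ - ψ) s

/-- A priori bounds for mild solutions, by Gronwall's inequality. -/
lemma exists_mild_bound (hl : ∀ n, 0 < l n) (hC0 : 0 ≤ C)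
    (hC : ∀ n, S₂.weight n ≤ C * l n * S₁.weight n) (R : ℝ) :
    ∃ M : ℝ, 0 ≤ M ∧ ∀ (v : C(J T, V)) (f : E₂) (φ : C(J T, E₂)), ‖f‖ + ‖v‖ ≤ R →
      IsMild S₁ S₂ hT N l v f φ →
      ‖φ‖ ≤ M ∧ ‖f‖ ^ 2 + C * ∫ s in (0 : ℝ)..T, ‖forcing hT N v φ s‖ ^ 2 ≤ M := by
  set b : ℝ := C * (‖N‖ * R) ^ 2
  have hb : 0 ≤ b := by positivity
  set A : ℝ := R ^ 2 * Real.exp (b * T)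
  have hA : 0 ≤ A := by positivity
  refine ⟨max √A (R ^ 2 + b * (T * A)), le_max_of_le_left (Real.sqrt_nonneg _),
    fun v f φ hfv h => ?_⟩
  have hf : ‖f‖ ≤ R := by linarith [norm_nonneg v]
  have hv : ‖v‖ ≤ R := by linarith [norm_nonneg f]
  have hF := continuous_forcing hT N v φ
  have hc := continuous_extendTime hT φ.continuous
  have h0 : ∀ t : ℝ, 0 ≤ t → ‖f‖ ^ 2 + C * ∫ s in (0 : ℝ)..t, ‖forcing hT N v φ s‖ ^ 2 ≤
      R ^ 2 + b * ∫ s in (0 : ℝ)..t, ‖extendTime hT φ s‖ ^ 2 := by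
    intro t ht
    have h2 : ∫ s in (0 : ℝ)..t, ‖forcing hT N v φ s‖ ^ 2 ≤
        ∫ s in (0 : ℝ)..t, (‖N‖ * R) ^ 2 * ‖extendTime hT φ s‖ ^ 2 := by
      refine intervalIntegral.integral_mono_on ht
        (Continuous.intervalIntegrable (by fun_prop) _ _)
        (Continuous.intervalIntegrable (by fun_prop) _ _) fun s _ => ?_
      rw [← mul_pow]
      refine pow_le_pow_left₀ (norm_nonneg _) ((norm_forcing_le hT N v φ s).trans ?_) 2
      gcongr
    rw [intervalIntegral.integral_const_mul] at h2
    have h3 := pow_le_pow_left₀ (norm_nonneg _) hf 2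
    have h4 := mul_le_mul_of_nonneg_left h2 hC0
    rw [← mul_assoc] at h4
    exact add_le_add h3 h4
  have h1 : ∀ t ∈ Icc 0 T, ‖extendTime hT φ t‖ ^ 2 ≤
      R ^ 2 + b * ∫ s in (0 : ℝ)..t, ‖extendTime hT φ s‖ ^ 2 := by
    intro t ht
    refine (mild_norm_sq_le S₁ S₂ hl hC f hF ht.1 fun n => ?_).trans (h0 t ht.1)
    have h5 := h ⟨t, ht⟩ n
    rwa [← extendTime_coe hT φ] at h5
  have h2 : ∀ t ∈ Icc 0 T, ‖extendTime hT φ t‖ ^ 2 ≤ A := by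
    intro t ht
    refine (le_mul_exp_of_le_integral (u := fun t => ‖extendTime hT φ t‖ ^ 2) (by fun_prop) hb h1
      t ht).trans ?_
    have := ht.2
    change R ^ 2 * Real.exp (b * t) ≤ R ^ 2 * Real.exp (b * T)
    gcongr
  constructor
  · refine le_max_of_le_left ((ContinuousMap.norm_le _ (Real.sqrt_nonneg _)).2 fun t => ?_)
    refine Real.le_sqrt_of_sq_le ?_
    have := h2 t t.2
    rwa [extendTime_coe] at this
  · refine le_max_of_le_right ((h0 T hT).trans ?_)
    have h3 : ∫ s in (0 : ℝ)..T, ‖extendTime hT φ s‖ ^ 2 ≤ ∫ _ in (0 : ℝ)..T, A :=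
      intervalIntegral.integral_mono_on hT (Continuous.intervalIntegrable (by fun_prop) _ _)
        (Continuous.intervalIntegrable (by fun_prop) _ _) h2
    rw [intervalIntegral.integral_const, sub_zero, smul_eq_mul] at h3
    gcongr

end Mild

/-! ### Mild solutions and weak time derivatives -/

lemma integral_timeMeasure {E : Type*} [NormedAddCommGroup E] [NormedSpace ℝ E] {T : ℝ}
    (hT : 0 ≤ T) (f : ℝ → E) : ∫ t, f t.1 ∂(timeMeasure T) = ∫ t in (0 : ℝ)..T, f t := by
  rw [integral_subtype_comap measurableSet_Icc f, integral_Icc_eq_integral_Ioc,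
    intervalIntegral.integral_of_le hT]

instance isFiniteMeasure_timeMeasure (T : ℝ) : IsFiniteMeasure (timeMeasure T) := by
  refine ⟨?_⟩
  rw [(MeasurableEmbedding.subtype_coe measurableSet_Icc).comap_apply, image_univ,
    Subtype.range_coe, Real.volume_Icc]
  exact ENNReal.ofReal_lt_top

lemma integrable_timeMeasure {T : ℝ} {p : J T → ℝ} (hp : Continuous p) :
    Integrable p (timeMeasure T) := by
  obtain ⟨C, hC⟩ := isCompact_univ.exists_bound_of_continuousOn hp.continuousOn
  exact (MemLp.of_bound hp.aestronglyMeasurable C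
    (Filter.Eventually.of_forall fun x => hC x (mem_univ x))).integrable le_rfl

lemma clm_integral_smul {E : Type} [NormedAddCommGroup E] [NormedSpace ℝ E] [CompleteSpace E]
    {T : ℝ} (L : E →L[ℝ] ℝ) (g : L2Time T E) {θ : ℝ → ℝ} (hθ : Continuous θ) :
    L (∫ t, θ t.1 • g t ∂(timeMeasure T)) = ∫ t, θ t.1 * L (g t) ∂(timeMeasure T) := by
  have hc : Continuous fun t : J T => θ t.1 := by fun_prop
  obtain ⟨C, hC⟩ := isCompact_univ.exists_bound_of_continuousOn hc.continuousOn
  have hi : Integrable (fun t : J T => θ t.1 • g t) (timeMeasure T) :=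
    ((Lp.memLp g).integrable one_le_two).bdd_smul C hc.aestronglyMeasurable
      (Filter.Eventually.of_forall fun x => hC x (mem_univ x))
  rw [← L.integral_comp_comm hi]
  simp only [map_smul, smul_eq_mul]

section Weak

variable {ι V : Type*} {E₁ E₂ E₃ : Type} [NormedAddCommGroup V] [NormedSpace ℝ V]
  [NormedAddCommGroup E₁] [NormedSpace ℝ E₁] [NormedAddCommGroup E₂] [NormedSpace ℝ E₂]
  [NormedAddCommGroup E₃] [NormedSpace ℝ E₃]
  (S₁ : CoefSystem ι E₁) (S₂ : CoefSystem ι E₂) (S₃ : CoefSystem ι E₃)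
  {l : ι → ℝ} {C C₁ C₃ T : ℝ} {N : V →L[ℝ] E₂ →L[ℝ] E₁} {v : C(J T, V)} {f : E₂} {φ : C(J T, E₂)}

/-- Weak solutions are mild solutions: each coordinate solves a scalar linear equation. -/
lemma isMild_of_isWeakTimeDeriv [CompleteSpace E₁] (hT : 0 < T) {g h : L2Time T E₁}
    (hg : ∀ᵐ t ∂(timeMeasure T), ∀ n, S₁.coef n (g t) = S₂.coef n (φ t))
    (hw : IsWeakTimeDeriv g h)
    (hh : ∀ᵐ t ∂(timeMeasure T), ∀ n, S₁.coef n (h t) =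
      -(l n * S₂.coef n (φ t)) - S₁.coef n (N (v t) (φ t)))
    (h0 : φ ⟨0, left_mem_Icc.2 hT.le⟩ = f) : IsMild S₁ S₂ hT.le N l v f φ := by
  intro t n
  have hc := continuous_extendTime hT.le φ.continuous
  have hF := continuous_forcing hT.le N v φ
  have h1 := eq_duhamel_of_weakDeriv (p := fun s => S₂.coef n (extendTime hT.le φ s))
    (F := fun s => S₁.coef n (forcing hT.le N v φ s)) (by fun_prop) (by fun_prop) hT (l n) ?_ t t.2
  · have h2 := extendTime_coe hT.le φ ⟨0, left_mem_Icc.2 hT.le⟩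
    simp only at h2
    simp only [extendTime_coe, h2, h0] at h1
    exact h1
  · intro θ hθ hs
    have h2 := congr_arg (S₁.coef n) (hw θ hθ hs)
    rw [map_neg, clm_integral_smul _ _ (hθ.continuous_deriv (by simp)),
      clm_integral_smul _ _ hθ.continuous] at h2
    rw [← integral_timeMeasure hT.le, ← integral_timeMeasure hT.le]
    convert h2 using 1
    · refine integral_congr_ae ?_
      filter_upwards [hg] with s hs
      rw [extendTime_coe, hs]
    · congr 1
      refine integral_congr_ae ?_
      filter_upwards [hh] with s hs
      rw [hs, forcing, extendTime_coe, extendTime_coe, map_neg, sub_eq_add_neg]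

variable {hT : 0 ≤ T}

lemma IsMild.integral_sq (h : IsMild S₁ S₂ hT N l v f φ) (n : ι) :
    ∫ t, S₂.coef n (φ t) ^ 2 ∂(timeMeasure T) =
      ∫ t in (0 : ℝ)..T, mild S₁ S₂ l f (forcing hT N v φ) n t ^ 2 := by
  rw [← integral_timeMeasure hT]
  simp only [h _ n]

variable [Countable ι]

/-- A mild solution gains a derivative in `L²` in time. -/
lemma IsMild.summable_integral_sq (h : IsMild S₁ S₂ hT N l v f φ) (hl : ∀ n, 0 < l n)
    (hC : ∀ n, S₂.weight n ≤ C * l n * S₁.weight n)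
    (hC₃ : ∀ n, S₃.weight n ≤ C₃ * l n * S₂.weight n) :
    Summable fun n => S₃.weight n * ∫ t, S₂.coef n (φ t) ^ 2 ∂(timeMeasure T) := by
  refine Summable.of_nonneg_of_le
    (fun n => mul_nonneg (S₃.weight_pos n).le (integral_nonneg fun t => sq_nonneg _)) (fun n => ?_)
    ((mild_dissipation S₁ S₂ hl hC f (continuous_forcing hT N v φ) hT).1.mul_left C₃)
  rw [h.integral_sq]
  have := mul_le_mul_of_nonneg_right (hC₃ n)
    (intervalIntegral.integral_nonneg (μ := volume) hT
      fun s _ => sq_nonneg (mild S₁ S₂ l f (forcing hT N v φ) n s))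
  linarith

lemma IsMild.exists_L2Time (h : IsMild S₁ S₂ hT N l v f φ) (hl : ∀ n, 0 < l n)
    (hC : ∀ n, S₂.weight n ≤ C * l n * S₁.weight n)
    (hC₃ : ∀ n, S₃.weight n ≤ C₃ * l n * S₂.weight n) :
    ∃ g : L2Time T E₃, ∀ᵐ t ∂(timeMeasure T), ∀ n, S₃.coef n (g t) = S₂.coef n (φ t) :=
  S₃.exists_Lp_coef_eq (fun n => Continuous.aestronglyMeasurable (by fun_prop))
    (fun n => integrable_timeMeasure (by fun_prop)) (h.summable_integral_sq S₁ S₂ S₃ hl hC hC₃)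

lemma IsMild.norm_L2Time_sq_le (h : IsMild S₁ S₂ hT N l v f φ) (hl : ∀ n, 0 < l n)
    (hC : ∀ n, S₂.weight n ≤ C * l n * S₁.weight n) (hC₃0 : 0 ≤ C₃)
    (hC₃ : ∀ n, S₃.weight n ≤ C₃ * l n * S₂.weight n) {g : L2Time T E₃}
    (hg : ∀ᵐ t ∂(timeMeasure T), ∀ n, S₃.coef n (g t) = S₂.coef n (φ t)) :
    ‖g‖ ^ 2 ≤ C₃ * (‖f‖ ^ 2 + C * ∫ s in (0 : ℝ)..T, ‖forcing hT N v φ s‖ ^ 2) := by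
  have hs := h.summable_integral_sq S₁ S₂ S₃ hl hC hC₃
  have hd := mild_dissipation S₁ S₂ hl hC f (continuous_forcing hT N v φ) hT
  refine (S₃.norm_Lp_sq_le (fun n => integrable_timeMeasure (by fun_prop)) hs hg).trans ?_
  refine le_trans ?_ (mul_le_mul_of_nonneg_left hd.2 hC₃0)
  rw [← tsum_mul_left]
  refine hs.tsum_le_tsum (fun n => ?_) (hd.1.mul_left C₃)
  rw [h.integral_sq]
  have := mul_le_mul_of_nonneg_right (hC₃ n)
    (intervalIntegral.integral_nonneg (μ := volume) hT
      fun s _ => sq_nonneg (mild S₁ S₂ l f (forcing hT N v φ) n s))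
  linarith

/-- Mild solutions have a weak time derivative in `L²`. -/
lemma IsMild.exists_isWeakTimeDeriv [CompleteSpace E₁] (h : IsMild S₁ S₂ hT N l v f φ)
    (hl : ∀ n, 0 < l n) (hC : ∀ n, S₂.weight n ≤ C * l n * S₁.weight n)
    (hC₁ : ∀ n, l n * S₁.weight n ≤ C₁ * S₂.weight n)
    (hC₃ : ∀ n, S₁.weight n ≤ C₃ * l n * S₂.weight n) :
    ∃ g h : L2Time T E₁,
      (∀ᵐ t ∂(timeMeasure T), ∀ n, S₁.coef n (g t) = S₂.coef n (φ t)) ∧ IsWeakTimeDeriv g h ∧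
      ∀ᵐ t ∂(timeMeasure T), ∀ n, S₁.coef n (h t) =
        -(l n * S₂.coef n (φ t)) - S₁.coef n (N (v t) (φ t)) := by
  obtain ⟨g, hg⟩ := h.exists_L2Time S₁ S₂ S₁ hl hC hC₃
  have hF := continuous_forcing hT N v φ
  have hFt : ∀ t : J T, forcing hT N v φ t = -N (v t) (φ t) := fun t => by
    rw [forcing, extendTime_coe, extendTime_coe]
  have hNc : Continuous fun t : J T => N (v t) (φ t) := by fun_prop
  have hyc : ∀ n, Continuous fun t : J T =>
      -(l n * S₂.coef n (φ t)) - S₁.coef n (N (v t) (φ t)) := fun n => by fun_prop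
  have hs : Summable fun n => S₁.weight n * ∫ t,
      (-(l n * S₂.coef n (φ t)) - S₁.coef n (N (v t) (φ t))) ^ 2 ∂(timeMeasure T) := by
    refine Summable.of_nonneg_of_le
      (fun n => mul_nonneg (S₁.weight_pos n).le (integral_nonneg fun t => sq_nonneg _))
      (fun n => ?_) (((mild_dissipation S₁ S₂ hl hC f hF hT).1.mul_left (2 * C₁)).add
        ((S₁.hasSum_integral hF T).summable.mul_left 2))
    have h1 : ∫ t, (-(l n * S₂.coef n (φ t)) - S₁.coef n (N (v t) (φ t))) ^ 2 ∂(timeMeasure T) ≤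
        2 * l n ^ 2 * (∫ t, S₂.coef n (φ t) ^ 2 ∂(timeMeasure T)) +
        2 * ∫ t, S₁.coef n (N (v t) (φ t)) ^ 2 ∂(timeMeasure T) := by
      rw [← integral_const_mul, ← integral_const_mul,
        ← integral_add (integrable_timeMeasure (by fun_prop)) (integrable_timeMeasure (by fun_prop))]
      refine integral_mono (integrable_timeMeasure (by fun_prop))
        (integrable_timeMeasure (by fun_prop)) fun t => ?_
      simp only
      nlinarith [sq_nonneg (l n * S₂.coef n (φ t) - S₁.coef n (N (v t) (φ t)))]
    have h2 : ∫ t, S₁.coef n (N (v t) (φ t)) ^ 2 ∂(timeMeasure T) =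
        ∫ t in (0 : ℝ)..T, S₁.coef n (forcing hT N v φ t) ^ 2 := by
      rw [← integral_timeMeasure hT]
      simp only [hFt, map_neg, neg_sq]
    rw [h.integral_sq, h2] at h1
    have h3 := mul_le_mul_of_nonneg_left h1 (S₁.weight_pos n).le
    have h4 := mul_le_mul_of_nonneg_right (hC₁ n)
      (mul_nonneg (hl n).le (intervalIntegral.integral_nonneg (μ := volume) hT
        fun s _ => sq_nonneg (mild S₁ S₂ l f (forcing hT N v φ) n s)))
    rw [intervalIntegral.integral_const_mul]
    linarith
  obtain ⟨h', hh'⟩ := S₁.exists_Lp_coef_eq (fun n => (hyc n).aestronglyMeasurable)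
    (fun n => integrable_timeMeasure ((hyc n).pow 2)) hs
  refine ⟨g, h', hg, fun θ hθ hsupp => S₁.ext_coef fun n => ?_, hh'⟩
  rw [map_neg, clm_integral_smul _ _ (hθ.continuous_deriv (by simp)),
    clm_integral_smul _ _ hθ.continuous]
  have key := weakDeriv_duhamel (l n) (S₂.coef n f)
    (F := fun s => S₁.coef n (forcing hT N v φ s)) (by fun_prop) hθ hsupp
  rw [← integral_timeMeasure hT, ← integral_timeMeasure hT] at key
  convert key using 1
  · refine integral_congr_ae ?_
    filter_upwards [hg] with s hs
    rw [hs, h s n, mild]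
  · congr 1
    refine integral_congr_ae ?_
    filter_upwards [hh'] with s hs
    rw [hs, h s n, mild, hFt, map_neg, sub_eq_add_neg]

end Weak

/-! ### Solutions of the advection-diffusion equation -/

/-- The Sobolev space `H^m` as a weighted `ℓ²` space of Hartley coefficients. -/
noncomputable def hartleySystem (d m : ℕ) : CoefSystem {n : Fin d → ℤ // n ≠ 0} (H d m) where
  weight n := weight m n.1
  coef n := coef n.1
  vec := hWave m
  weight_pos n := weight_pos m n.1
  hasSum_sq := hasSum_weight_mul_coef_sq
  hasSum_vec u := by
    refine ((hBasis d m).hasSum_repr u).congr_fun fun n => ?_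
    have h3 : √(weight m n.1) ≠ 0 := (Real.sqrt_pos.2 (weight_pos m n.1)).ne'
    rw [hBasis_repr, hBasis_apply, smul_smul]
    congr 1
    field_simp
  exists_coef _ ha := exists_coef_eq ha

lemma toL2_eq_iff_coef {d m m' : ℕ} {u : H d m} {w : H d m'} :
    toL2 u = toL2 w ↔ ∀ n, (hartleySystem d m).coef n u = (hartleySystem d m').coef n w :=
  ⟨fun h n => by change coef n.1 u = coef n.1 w; rw [coef_apply, coef_apply, h],
    fun h => toL2_eq_of_coef fun n hn => h ⟨n, hn⟩⟩

section Solution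

set_option synthInstance.maxHeartbeats 400000

/-- The equation at a fixed time, in terms of Hartley coefficients. -/
lemma equation_iff_coef {d k : ℕ} {N : HSigma d (k + 2) →L[ℝ] H d (k + 2) →L[ℝ] H d (k + 1)}
    (hN : ∀ v φ, toL2 (N v φ) =ᵐ[volume] advFun v φ) (v : HSigma d (k + 2)) (φ : H d (k + 2))
    (u : H d (k + 1)) :
    (∀ᵐ x : Torus d, toL2 u x + ∑ j, toL2 (v.1 j) x * dx j φ x - laplacian φ x = 0) ↔
      ∀ n, (hartleySystem d (k + 1)).coef n u = -(freqSq n.1 * (hartleySystem d (k + 2)).coef n φ) -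
        (hartleySystem d (k + 1)).coef n (N v φ) := by
  have h1 : (∀ᵐ x : Torus d, toL2 u x + ∑ j, toL2 (v.1 j) x * dx j φ x - laplacian φ x = 0) ↔
      toL2 u + toL2 (N v φ) = laplacian φ := by
    constructor
    · intro h
      refine Lp.ext ?_
      filter_upwards [h, hN v φ, Lp.coeFn_add (toL2 u) (toL2 (N v φ))] with x h1 h2 h3
      rw [h3, Pi.add_apply, h2, advFun]
      linarith
    · intro h
      have h4 := Lp.coeFn_add (toL2 u) (toL2 (N v φ))
      rw [h] at h4
      filter_upwards [hN v φ, h4] with x h2 h3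
      rw [h3, Pi.add_apply, h2, advFun]
      ring
  rw [h1]
  constructor
  · intro h n
    have h2 := congr_arg (inner ℝ (hart 0 n.1)) h
    rw [inner_add_right, inner_hart_laplacian, ← coef_apply, ← coef_apply] at h2
    change coef n.1 u = -(freqSq n.1 * coef n.1 φ) - coef n.1 (N v φ)
    linarith
  · intro h
    refine toL2_ext fun n => ?_
    rw [inner_add_right, inner_hart_laplacian, ← coef_apply, ← coef_apply]
    by_cases hn : n = 0
    · rw [hn, coef_zero, coef_zero, coef_zero]
      simp
    · have h2 : coef n u = -(freqSq n * coef n φ) - coef n (N v φ) := h ⟨n, hn⟩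
      linarith

variable {d k : ℕ} {T : ℝ} {hT : 0 < T}
  {N : HSigma d (k + 2) →L[ℝ] H d (k + 2) →L[ℝ] H d (k + 1)}
  {v : C(J T, HSigma d (k + 2))} {f : H d (k + 2)} {φ : C(J T, H d (k + 2))}

lemma freqSq_pos {n : Fin d → ℤ} (hn : n ≠ 0) : 0 < freqSq n := one_pos.trans_le (one_le_freqSq hn)

/-- Solutions of the advection-diffusion equation are the mild solutions. -/
lemma isSolution_iff_isMild (hN : ∀ v φ, toL2 (N v φ) =ᵐ[volume] advFun v φ) :
    IsSolution hT v f φ ↔ IsMild (hartleySystem d (k + 1)) (hartleySystem d (k + 2)) hT.le N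
      (fun n => freqSq n.1) v f φ := by
  constructor
  · rintro ⟨-, ⟨g, h, hg, hw, he⟩, h0⟩
    refine isMild_of_isWeakTimeDeriv _ _ hT ?_ hw ?_ h0
    · filter_upwards [hg] with t ht
      exact toL2_eq_iff_coef.1 ht
    · filter_upwards [he] with t ht
      exact (equation_iff_coef hN _ _ _).1 ht
  · intro h
    have hl : ∀ n : {n : Fin d → ℤ // n ≠ 0}, 0 < freqSq n.1 := fun n => freqSq_pos n.2
    obtain ⟨C₁, -, hC₁⟩ := exists_freqSq_mul_weight_le d (k + 1)
    obtain ⟨C₂, -, hC₂⟩ := exists_weight_succ_le d (k + 1)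
    obtain ⟨C₃, -, hC₃⟩ := exists_weight_succ_le d (k + 2)
    refine ⟨?_, ?_, ?_⟩
    · obtain ⟨g, hg⟩ := h.exists_L2Time _ _ (hartleySystem d (k + 3)) hl (fun n => hC₂ n.1 n.2)
        (fun n => hC₃ n.1 n.2)
      refine ⟨g, ?_⟩
      filter_upwards [hg] with t ht
      exact toL2_eq_iff_coef.2 ht
    · obtain ⟨g, h', hg, hw, he⟩ := h.exists_isWeakTimeDeriv _ _ hl (fun n => hC₂ n.1 n.2)
        (fun n => hC₁ n.1) fun n =>
          (weight_mono (m := k + 1) (m' := k + 3) (by omega) n.1).trans (hC₃ n.1 n.2)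
      refine ⟨g, h', ?_, hw, ?_⟩
      · filter_upwards [hg] with t ht
        exact toL2_eq_iff_coef.2 ht
      · filter_upwards [he] with t ht
        exact (equation_iff_coef hN _ _ _).2 ht
    · refine (hartleySystem d (k + 2)).ext_coef fun n => ?_
      rw [h, mild, duhamel_zero]

lemma existsUnique_isSolution (hk : d < 2 * (k + 1)) (hT : 0 < T)
    (v : C(J T, HSigma d (k + 2))) (f : H d (k + 2)) : ∃! φ, IsSolution hT v f φ := by
  obtain ⟨N, hN⟩ := exists_advection hk
  obtain ⟨C₂, hC₂0, hC₂⟩ := exists_weight_succ_le d (k + 1)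
  simp only [isSolution_iff_isMild hN]
  exact existsUnique_isMild (hartleySystem d (k + 1)) (hartleySystem d (k + 2)) hT.le N
    (fun n => freqSq_pos n.2) hC₂0.le (fun n => hC₂ n.1 n.2) v f

/-- The norms of solutions in `C(J_T; H^{k+2})` and `L²(J_T; H^{k+3})` are bounded on bounded sets
of data. -/
lemma exists_solution_bound (hk : d < 2 * (k + 1)) (hT : 0 < T) (R : ℝ) :
    ∃ C : ℝ, 0 < C ∧ ∀ (f : H d (k + 2)) (v : C(J T, HSigma d (k + 2))), ‖f‖ + ‖v‖ ≤ R →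
      ∀ φ : C(J T, H d (k + 2)), IsSolution hT v f φ →
        ∀ g : L2Time T (H d (k + 3)), Represents g φ → ‖φ‖ + ‖g‖ ≤ C := by
  obtain ⟨N, hN⟩ := exists_advection hk
  obtain ⟨C₂, hC₂0, hC₂⟩ := exists_weight_succ_le d (k + 1)
  obtain ⟨C₃, hC₃0, hC₃⟩ := exists_weight_succ_le d (k + 2)
  have hl : ∀ n : {n : Fin d → ℤ // n ≠ 0}, 0 < freqSq n.1 := fun n => freqSq_pos n.2
  obtain ⟨M, hM0, hM⟩ := exists_mild_bound (hartleySystem d (k + 1)) (hartleySystem d (k + 2))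
    hT.le N hl hC₂0.le (fun n => hC₂ n.1 n.2) R
  refine ⟨M + √(C₃ * M) + 1, by positivity, fun f v hfv φ hφ g hg => ?_⟩
  rw [isSolution_iff_isMild hN] at hφ
  obtain ⟨h1, h2⟩ := hM v f φ hfv hφ
  have h3 := hφ.norm_L2Time_sq_le _ _ (hartleySystem d (k + 3)) hl (fun n => hC₂ n.1 n.2) hC₃0.le
    (fun n => hC₃ n.1 n.2) (g := g) (by
      filter_upwards [hg] with t ht
      exact toL2_eq_iff_coef.1 ht)
  have h4 : ‖g‖ ≤ √(C₃ * M) :=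
    Real.le_sqrt_of_sq_le (h3.trans (mul_le_mul_of_nonneg_left h2 hC₃0.le))
  linarith

end Solution

end AdvDiff

theorem proposition3p1 (d k : ℕ) (hd : 2 ≤ d) (hk : (d : ℝ) / 2 < k) (T : ℝ) (hT : 0 < T) :
    (∀ (f : AdvDiff.H d (k + 2)) (v : C(AdvDiff.J T, AdvDiff.HSigma d (k + 2))),
      ∃! φ : C(AdvDiff.J T, AdvDiff.H d (k + 2)), AdvDiff.IsSolution hT v f φ) ∧
    ∀ R : ℝ, 0 < R → ∃ C : ℝ, 0 < C ∧
      ∀ (f : AdvDiff.H d (k + 2)) (v : C(AdvDiff.J T, AdvDiff.HSigma d (k + 2))),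
        ‖f‖ + ‖v‖ ≤ R →
        ∀ φ : C(AdvDiff.J T, AdvDiff.H d (k + 2)), AdvDiff.IsSolution hT v f φ →
          ∀ g : AdvDiff.L2Time T (AdvDiff.H d (k + 3)), AdvDiff.Represents g φ →
            ‖φ‖ + ‖g‖ ≤ C := by
  have hk' : d < 2 * (k + 1) := by
    have h1 : (d : ℝ) < 2 * k := by linarith
    have h2 : d < 2 * k := by exact_mod_cast h1
    omega
  exact ⟨fun f v => AdvDiff.existsUnique_isSolution hk' hT v f,
    fun R _ => AdvDiff.exists_solution_bound hk' hT R⟩
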